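/- **Theorem (Heisenberg model with partial dilation, finite-dimensional).** Let $\lambda,\xi>0$. On $\mathbb R^3$ with coordinates $w=(x,y,z)$ let $$X=\partial_x+\tfrac12 y\,\partial_z,\qquad Y=\partial_y-\tfrac12 x\,\partial_z,\qquad L=X^2+\xi Y-\lambda x\,\partial_x,$$ and let $V=\kappa\,\partial_x+\kappa^{-1}\partial_z$ with $\kappa=\sqrt{2\lambda/\xi}$. Call a family $(P_t)_{t\ge 0}$ of Markov kernels on $\mathbb R^3$ a Markov semigroup generated by $L$ if $P_0=\mathrm{Id}$, $P_{s+t}=P_sP_t$ for all $s,t\ge0$, and $\frac1t(P_tf-f)\to Lf$ uniformly on $\mathbb R^3$ as $t\downarrow0$ for every $f\in C_c^\infty(\mathbb R^3)$. Then: 1. There is exactly one Markov semigroup $(P_t)_{t\ge0}$ generated by $L$; write $f_t=P_tf$. 2. Let $t\ge 0$ and let $f:\mathbb R^3\to\mathbb R$ be a Borel function which has a directional derivative $Vf(w)$ at every $w\in\mathbb R^3$ and for which $P_t|f|(w)<\infty$ for every $w$. Then $f_t$ has a directional derivative $Vf_t(w)$ at every $w\in\mathbb R^3$, and $$\bigl(Vf_t\bigr)^2(w)\;\le\;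 e^{-2\lambda t}\,P_t\bigl((Vf)^2\bigr)(w)\qquad\text{for every } w\in\mathbb R^3,$$ where the right-hand side is an element of $[0,\infty]$. 3. There is no probability measure $\mu$ on $\mathbb R^3$ with $\mu P_t=\mu$ for all $t\ge0$. -/

import Mathlib

open MeasureTheory ProbabilityTheory Filter Topology
open scoped NNReal ENNReal ContDiff

namespace Heisenberg

/-- The underlying space `ℝ³` of the Heisenberg group; a point is `w = (x, y, z)`. -/
abbrev Space : Type := ℝ × ℝ × ℝ

/-- The action of a vector field `U` on a function `f`: `(U f)(w)` is the derivative of `f` at `w`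
in the direction `U w`. -/
noncomputable def act (U : Space → Space) (f : Space → ℝ) : Space → ℝ :=
  fun w => lineDeriv ℝ f w (U w)

/-- `X = ∂_x + (y / 2) ∂_z`. -/
noncomputable def fieldX : Space → Space := fun w => (1, 0, w.2.1 / 2)

/-- `Y = ∂_y - (x / 2) ∂_z`. -/
noncomputable def fieldY : Space → Space := fun w => (0, 1, -(w.1 / 2))

/-- The partial dilation `D₀ = x ∂_x`. -/
def fieldD : Space → Space := fun w => (w.1, 0, 0)

/-- The constant field `V = κ ∂_x + κ⁻¹ ∂_z` with `κ = √(2 lam / ξ)`. -/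
noncomputable def fieldV (lam ξ : ℝ) : Space → Space :=
  fun _ => (Real.sqrt (2 * lam / ξ), 0, (Real.sqrt (2 * lam / ξ))⁻¹)

/-- `L = X² + ξ Y - lam x ∂_x`. -/
noncomputable def generator (lam ξ : ℝ) (f : Space → ℝ) : Space → ℝ :=
  fun w => act fieldX (act fieldX f) w + ξ * act fieldY f w - lam * act fieldD f w

/-- `(P_t f)(w) = ∫ f(w') P_t(w, dw')`. -/
noncomputable def semigroupAct (P : ℝ≥0 → Kernel Space Space) (t : ℝ≥0) (f : Space → ℝ) :
    Space → ℝ :=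
  fun w => ∫ w', f w' ∂(P t w)

/-- `P` is a Markov semigroup generated by `L`: a semigroup of Markov kernels whose infinitesimal
generator (for uniform convergence) is `L` on smooth compactly supported functions. -/
structure IsMarkovSemigroupGeneratedBy (L : (Space → ℝ) → (Space → ℝ))
    (P : ℝ≥0 → Kernel Space Space) : Prop where
  markov : ∀ t, IsMarkovKernel (P t)
  zero : P 0 = Kernel.id
  add : ∀ s t, P (s + t) = (P t).comp (P s)
  infinitesimal : ∀ f : Space → ℝ, ContDiff ℝ ∞ f → HasCompactSupport f →
    TendstoUniformly (fun (t : ℝ≥0) w => (semigroupAct P t f w - f w) / (t : ℝ)) (L f)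
      (𝓝[>] (0 : ℝ≥0))

end Heisenberg

/-!
The operator `L` generates the diffusion `dx = √2 dB - lam x dt`, `dy = ξ dt`,
`dz = (y / 2) √2 dB - (ξ x / 2) dt`, which can be solved explicitly. With `e = e^{-lam t}`, the
solution at time `t` is the image of the starting point under the flow of the drift plus a centred
Gaussian noise (`solution`). The noise is a linear function of the three jointly Gaussian variables
`√2 ∫ e^{-lam (t - s)} dB_s`, `B_t` and `∫ s dB_s`, with coefficients affine in `y`. No stochastic
calculus is needed: the covariance matrix of these variables has an explicit Cholesky
decomposition (`chol₁`, `chol₂`, `chol₃`), so that `P_t(w, ·)` (`solutionKernel`) can be defined as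
the image of the standard Gaussian measure on `ℝ³` under an explicit affine map.

*Existence.* The semigroup property is a cocycle identity for the variances, by characteristic
functions (`solutionKernel_add`). The generator is found by Taylor's formula: the noise contributes
`X² f` and the flow of the drift contributes `ξ Y f - lam x ∂_x f`. The errors are uniform because
all terms are governed by continuous functions of compact support (`solution_first_order`).

*Uniqueness.* For another semigroup `Q` generated by `L` and a test function `f`, the function
`s ↦ Q_{t - s} P_s f` is constant, since `Q_h P_s f - P_h P_s f = o(h)`
(`semigroupAct_sub_isLittleO`). The function `P_s f` has no compact support, but it is a mixture of
the functions `w ↦ f (solution s w N)`, which do have compact support, since for frozen noise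
`N` the solution map is an affine bijection. The bound `|Q_h φ - φ| ≤ h sup |L φ|`
(`abs_semigroupAct_sub_le`) dominates the mixture.

*Gradient estimate.* The drift flow contracts `V` exactly by the factor `e`, so
`P_t f (w + h V) = ∫ f (w' + h e V) P_t(w, dw')`. For `t > 0` the noise in the direction `V` is
non-degenerate conditionally on `B_t` and `∫ s dB_s` (`chol₃_pos`): this makes `P_t f`
differentiable along `V` for every `f` that is integrable for all `P_t(w, ·)`
(`hasDerivAt_integral_shift`). When `V f` is square integrable, Gaussian integration by parts along
each line in the direction `V` gives `V P_t f = e P_t (V f)`, and the Cauchy–Schwarz inequality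
finishes the proof; otherwise the right-hand side is infinite.

*No invariant measure.* The coordinate `y` moves with constant speed `ξ > 0`.
-/

namespace Heisenberg

/-! ### The explicit solution of the stochastic differential equation -/

/-- The factor `e^{-lam t}` by which the drift `-lam x ∂_x` contracts `x` in time `t`. -/
noncomputable def decay (lam t : ℝ) : ℝ := Real.exp (-(lam * t))

/-- The first Cholesky coefficient of the noise in `x`: its covariance with the Brownian motion at
time `t`, divided by the standard deviation of the latter. For `t = 0` the division by zero gives
the correct value `0`. -/
noncomputable def chol₁ (lam t : ℝ) : ℝ := 2 * (1 - decay lam t) / (lam * √(2 * t))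

/-- The second Cholesky coefficient of the noise in `x`: its covariance with the part of
`√2 ∫ s dB_s` that is independent of `B_t`, divided by the standard deviation of that part. -/
noncomputable def chol₂ (lam t : ℝ) : ℝ :=
  (t * (1 + decay lam t) / lam - 2 * (1 - decay lam t) / lam ^ 2) / √(t ^ 3 / 6)

/-- The third Cholesky coefficient of the noise in `x`: the standard deviation of the part of
`√2 ∫ e^{-lam (t - s)} dB_s` that is independent of `B_t` and of `∫ s dB_s`. -/
noncomputable def chol₃ (lam t : ℝ) : ℝ :=
  √((1 - decay lam t ^ 2) / lam - chol₁ lam t ^ 2 - chol₂ lam t ^ 2)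

/-- The random variable `√2 ∫₀ᵗ e^{-lam (t - s)} dB_s` in terms of three independent standard
Gaussian variables. -/
noncomputable def noiseA (lam t : ℝ) (N : Space) : ℝ :=
  chol₁ lam t * N.1 + chol₂ lam t * N.2.1 + chol₃ lam t * N.2.2

/-- The random variable `√2 B_t` in terms of three independent standard Gaussian variables. -/
noncomputable def noiseB (t : ℝ) (N : Space) : ℝ := √(2 * t) * N.1

/-- The random variable `(ξ / √2) ∫₀ᵗ s dB_s` in terms of three independent standard Gaussian
variables. -/
noncomputable def noiseC (ξ t : ℝ) (N : Space) : ℝ :=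
  ξ / 2 * (t / 2 * (√(2 * t) * N.1) + √(t ^ 3 / 6) * N.2.1)

/-- The flow of the drift field `ξ Y - lam x ∂_x`. -/
noncomputable def driftFlow (lam ξ t : ℝ) (w : Space) : Space :=
  (decay lam t * w.1, w.2.1 + ξ * t, w.2.2 - ξ / (2 * lam) * (1 - decay lam t) * w.1)

/-- The noise added in time `t` to a point whose second coordinate is `y`. -/
noncomputable def noise (lam ξ t y : ℝ) (N : Space) : Space :=
  (noiseA lam t N, 0,
    ξ / (2 * lam) * noiseA lam t N + (y / 2 - ξ / (2 * lam)) * noiseB t N + noiseC ξ t N)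

/-- The solution at time `t`, started at `w`, of the stochastic differential equation
`dx = √2 dB - lam x dt`, `dy = ξ dt`, `dz = (y / 2) √2 dB - (ξ x / 2) dt`. -/
noncomputable def solution (lam ξ t : ℝ) (w N : Space) : Space :=
  driftFlow lam ξ t w + noise lam ξ t w.2.1 N

/-- The standard Gaussian measure on `ℝ³`. -/
noncomputable def stdGauss : Measure Space :=
  (gaussianReal 0 1).prod ((gaussianReal 0 1).prod (gaussianReal 0 1))

instance : IsProbabilityMeasure stdGauss := by unfold stdGauss; infer_instance

lemma decay_pos (lam t : ℝ) : 0 < decay lam t := Real.exp_pos _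

lemma decay_zero (lam : ℝ) : decay lam 0 = 1 := by simp [decay]

lemma decay_add (lam s t : ℝ) : decay lam (s + t) = decay lam s * decay lam t := by
  rw [decay, decay, decay, ← Real.exp_add]; congr 1; ring

lemma decay_le_one {lam t : ℝ} (hlam : 0 < lam) (ht : 0 ≤ t) : decay lam t ≤ 1 :=
  Real.exp_le_one_iff.mpr (by have := mul_nonneg hlam.le ht; linarith)

lemma one_sub_decay_le (lam t : ℝ) : 1 - decay lam t ≤ lam * t := by
  have := Real.add_one_le_exp (-(lam * t)); unfold decay; linarith

lemma chol₁_mul {lam t : ℝ} (hlam : 0 < lam) (ht : 0 ≤ t) :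
    chol₁ lam t * √(2 * t) = 2 * (1 - decay lam t) / lam := by
  rcases ht.eq_or_lt with rfl | ht
  · simp [chol₁, decay]
  · have : √(2 * t) ≠ 0 := by positivity
    unfold chol₁; field_simp

lemma chol₂_mul {lam t : ℝ} (ht : 0 ≤ t) :
    chol₂ lam t * √(t ^ 3 / 6) =
      t * (1 + decay lam t) / lam - 2 * (1 - decay lam t) / lam ^ 2 := by
  rcases ht.eq_or_lt with rfl | ht
  · simp [chol₂, decay]
  · have : √(t ^ 3 / 6) ≠ 0 := by positivity
    unfold chol₂; field_simp

lemma sinh_lt_mul_cosh {h : ℝ} (hh : 0 < h) : Real.sinh h < h * Real.cosh h := by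
  have hmono : StrictMonoOn (fun h : ℝ => h * Real.cosh h - Real.sinh h) (Set.Ici 0) := by
    refine strictMonoOn_of_deriv_pos (convex_Ici 0) (by fun_prop) fun x hx => ?_
    rw [interior_Ici] at hx
    have hd : HasDerivAt (fun h : ℝ => h * Real.cosh h - Real.sinh h)
        (1 * Real.cosh x + x * Real.sinh x - Real.cosh x) x :=
      ((hasDerivAt_id x).mul (Real.hasDerivAt_cosh x)).sub (Real.hasDerivAt_sinh x)
    rw [hd.deriv]
    have := mul_pos hx (Real.sinh_pos_iff.mpr hx)
    linarith
  have := hmono (Set.mem_Ici.mpr le_rfl) hh.le hh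
  simp at this
  linarith

lemma three_mul_cosh_lt {h : ℝ} (hh : 0 < h) :
    3 * h * Real.cosh h < h ^ 2 * Real.sinh h + 3 * Real.sinh h := by
  have hmono : StrictMonoOn
      (fun h : ℝ => h ^ 2 * Real.sinh h + 3 * Real.sinh h - 3 * (h * Real.cosh h)) (Set.Ici 0) := by
    refine strictMonoOn_of_deriv_pos (convex_Ici 0) (by fun_prop) fun x hx => ?_
    rw [interior_Ici] at hx
    have hd : HasDerivAt
        (fun h : ℝ => h ^ 2 * Real.sinh h + 3 * Real.sinh h - 3 * (h * Real.cosh h))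
        ((2 * x) * Real.sinh x + x ^ 2 * Real.cosh x + 3 * Real.cosh x
          - 3 * (1 * Real.cosh x + x * Real.sinh x)) x := by
      have h1 : HasDerivAt (fun h : ℝ => h ^ 2) (2 * x) x := by simpa using hasDerivAt_pow 2 x
      exact ((h1.mul (Real.hasDerivAt_sinh x)).add ((Real.hasDerivAt_sinh x).const_mul 3)).sub
        (((hasDerivAt_id x).mul (Real.hasDerivAt_cosh x)).const_mul 3)
    rw [hd.deriv]
    have := mul_pos (Set.mem_Ioi.mp hx) (sub_pos.mpr (sinh_lt_mul_cosh hx))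
    nlinarith
  have := hmono (Set.mem_Ici.mpr le_rfl) hh.le hh
  simp at this
  linarith

/-- The variance of the noise in `x` conditional on `B_t` and `∫ s dB_s` is positive: the function
`e^{lam s}` is not affine. With `h = lam t / 2` the variance factors as a positive multiple of
`(h cosh h - sinh h) (h² sinh h + 3 sinh h - 3 h cosh h)`. -/
lemma residual_variance_pos {lam t : ℝ} (hlam : 0 < lam) (ht : 0 < t) :
    0 < (1 - decay lam t ^ 2) / lam - chol₁ lam t ^ 2 - chol₂ lam t ^ 2 := by
  obtain ⟨h, rfl⟩ : ∃ h, t = 2 * h / lam := ⟨lam * t / 2, by field_simp⟩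
  have hh : 0 < h := by
    rw [lt_div_iff₀ hlam] at ht; linarith
  have hm : 0 < Real.exp (-h) := Real.exp_pos _
  have hdecay : decay lam (2 * h / lam) = Real.exp (-h) ^ 2 := by
    rw [decay, ← Real.exp_nat_mul]; congr 1; push_cast; field_simp
  have hone : 1 = Real.exp (-h) * (Real.cosh h + Real.sinh h) := by
    rw [Real.cosh_add_sinh, ← Real.exp_add]; simp
  have hexp : Real.exp (-h) = Real.cosh h - Real.sinh h := (Real.cosh_sub_sinh h).symm
  have h1 : 1 - decay lam (2 * h / lam) = 2 * Real.exp (-h) * Real.sinh h := by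
    rw [hdecay]; nth_rewrite 1 [hone]; linear_combination (-Real.exp (-h)) * hexp
  have h2 : 1 + decay lam (2 * h / lam) = 2 * Real.exp (-h) * Real.cosh h := by
    rw [hdecay]; nth_rewrite 1 [hone]; linear_combination (Real.exp (-h)) * hexp
  have hsq : 1 - decay lam (2 * h / lam) ^ 2 =
      (1 - decay lam (2 * h / lam)) * (1 + decay lam (2 * h / lam)) := by ring
  rw [hsq, chol₁, chol₂, div_pow, div_pow, mul_pow lam, Real.sq_sqrt (by positivity),
    Real.sq_sqrt (by positivity), h1, h2]
  have h3 := mul_pos (sub_pos.mpr (sinh_lt_mul_cosh hh)) (sub_pos.mpr (three_mul_cosh_lt hh))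
  have key : 2 * Real.exp (-h) * Real.sinh h * (2 * Real.exp (-h) * Real.cosh h) / lam -
      (2 * (2 * Real.exp (-h) * Real.sinh h)) ^ 2 / (lam ^ 2 * (2 * (2 * h / lam))) -
      (2 * h / lam * (2 * Real.exp (-h) * Real.cosh h) / lam -
        2 * (2 * Real.exp (-h) * Real.sinh h) / lam ^ 2) ^ 2 / ((2 * h / lam) ^ 3 / 6) =
      4 * Real.exp (-h) ^ 2 / (lam * h ^ 3) * ((h * Real.cosh h - Real.sinh h) *
        (h ^ 2 * Real.sinh h + 3 * Real.sinh h - 3 * h * Real.cosh h)) := by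
    field_simp; ring
  rw [key]
  positivity

lemma chol₃_pos {lam t : ℝ} (hlam : 0 < lam) (ht : 0 < t) : 0 < chol₃ lam t :=
  Real.sqrt_pos.mpr (residual_variance_pos hlam ht)

/-- The variance of `√2 ∫₀ᵗ e^{-lam (t - s)} dB_s`. -/
lemma chol_sq_sum {lam t : ℝ} (hlam : 0 < lam) (ht : 0 ≤ t) :
    chol₁ lam t ^ 2 + chol₂ lam t ^ 2 + chol₃ lam t ^ 2 = (1 - decay lam t ^ 2) / lam := by
  rcases ht.eq_or_lt with rfl | ht
  · simp [chol₁, chol₂, chol₃, decay]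
  · rw [chol₃, Real.sq_sqrt (residual_variance_pos hlam ht).le]; ring

lemma solution_fst (lam ξ t : ℝ) (w N : Space) :
    (solution lam ξ t w N).1 = decay lam t * w.1 + noiseA lam t N := rfl

lemma solution_snd (lam ξ t : ℝ) (w N : Space) : (solution lam ξ t w N).2.1 = w.2.1 + ξ * t :=
  add_zero _

lemma continuous_solution (lam ξ t : ℝ) :
    Continuous fun p : Space × Space => solution lam ξ t p.1 p.2 := by
  unfold solution driftFlow noise noiseA noiseB noiseC; fun_prop

lemma measurable_solution (lam ξ t : ℝ) (w : Space) : Measurable (solution lam ξ t w) :=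
  ((continuous_solution lam ξ t).comp (Continuous.prodMk_right w)).measurable

/-- The law of the explicit solution at time `t`, as a kernel in the starting point. -/
noncomputable def solutionKernel (lam ξ : ℝ) (t : ℝ≥0) : Kernel Space Space where
  toFun w := stdGauss.map (solution lam ξ t w)
  measurable' := by
    have h : (fun w => stdGauss.map (solution lam ξ t w)) =
        fun w => (stdGauss.map (Prod.mk w)).map
          (fun p : Space × Space => solution lam ξ t p.1 p.2) := by
      funext w
      rw [Measure.map_map (continuous_solution lam ξ t).measurable measurable_prodMk_left]
      rfl
    rw [h]
    exact (Measure.measurable_map _ (continuous_solution lam ξ t).measurable).comp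
      Measurable.map_prodMk_left

lemma solutionKernel_apply (lam ξ : ℝ) (t : ℝ≥0) (w : Space) :
    solutionKernel lam ξ t w = stdGauss.map (solution lam ξ t w) := rfl

instance (lam ξ : ℝ) (t : ℝ≥0) : IsMarkovKernel (solutionKernel lam ξ t) :=
  ⟨fun w => Measure.isProbabilityMeasure_map (measurable_solution lam ξ t w).aemeasurable⟩

lemma semigroupAct_solutionKernel (lam ξ : ℝ) (t : ℝ≥0) {f : Space → ℝ} (hf : Measurable f)
    (w : Space) : semigroupAct (solutionKernel lam ξ) t f w =
      ∫ N, f (solution lam ξ t w N) ∂stdGauss := by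
  rw [semigroupAct, solutionKernel_apply,
    integral_map (measurable_solution lam ξ t w).aemeasurable hf.aestronglyMeasurable]

/-! ### The semigroup property, by characteristic functions -/

/-- The characteristic function of the standard Gaussian measure. -/
lemma integral_cexp_stdGauss (a₁ a₂ a₃ : ℝ) :
    ∫ N : Space, Complex.exp (((a₁ * N.1 + a₂ * N.2.1 + a₃ * N.2.2 : ℝ) : ℂ) * Complex.I)
      ∂stdGauss = Complex.exp (-((a₁ ^ 2 + a₂ ^ 2 + a₃ ^ 2 : ℝ) : ℂ) / 2) := by
  have hone : ∀ a : ℝ, ∫ s : ℝ, Complex.exp ((a : ℂ) * s * Complex.I) ∂(gaussianReal 0 1) =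
      Complex.exp (-((a ^ 2 : ℝ) : ℂ) / 2) := by
    intro a
    rw [← charFun_apply_real, charFun_gaussianReal]
    congr 1; push_cast; ring
  have hsplit : ∀ N : Space,
      Complex.exp (((a₁ * N.1 + a₂ * N.2.1 + a₃ * N.2.2 : ℝ) : ℂ) * Complex.I) =
        Complex.exp ((a₁ : ℂ) * N.1 * Complex.I) * (Complex.exp ((a₂ : ℂ) * N.2.1 * Complex.I) *
          Complex.exp ((a₃ : ℂ) * N.2.2 * Complex.I)) := by
    intro N
    rw [← Complex.exp_add, ← Complex.exp_add]
    congr 1; push_cast; ring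
  simp_rw [hsplit]
  rw [stdGauss, integral_prod_mul (fun s : ℝ => Complex.exp ((a₁ : ℂ) * s * Complex.I))
      (fun p : ℝ × ℝ => Complex.exp ((a₂ : ℂ) * p.1 * Complex.I) *
        Complex.exp ((a₃ : ℂ) * p.2 * Complex.I)),
    integral_prod_mul (fun s : ℝ => Complex.exp ((a₂ : ℂ) * s * Complex.I))
      (fun s : ℝ => Complex.exp ((a₃ : ℂ) * s * Complex.I)), hone, hone, hone,
    ← Complex.exp_add, ← Complex.exp_add]
  congr 1; push_cast; ring

/-- The variance at time `t` of `q · (noise in x) + r · (noise in z - ξ / (2 lam) · x)`, where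
`η = y / 2 - ξ / (2 lam)` encodes the second coordinate of the starting point. -/
noncomputable def noiseVariance (lam ξ t q r η : ℝ) : ℝ :=
  q ^ 2 * ((1 - decay lam t ^ 2) / lam)
    + 2 * q * r * (2 * η * (1 - decay lam t) / lam
        + ξ * (t / lam - (1 - decay lam t) / lam ^ 2))
    + 2 * r ^ 2 * (η ^ 2 * t + η * ξ * t ^ 2 / 2 + ξ ^ 2 * t ^ 3 / 12)

lemma noiseVariance_eq {lam t : ℝ} (hlam : 0 < lam) (ht : 0 ≤ t) (ξ q r η : ℝ) :
    (q * chol₁ lam t + r * ((η + ξ * t / 4) * √(2 * t))) ^ 2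
      + (q * chol₂ lam t + r * (ξ / 2 * √(t ^ 3 / 6))) ^ 2 + (q * chol₃ lam t) ^ 2 =
    noiseVariance lam ξ t q r η := by
  have h0 := chol_sq_sum hlam ht
  have h1 := chol₁_mul hlam ht
  have h2 := chol₂_mul (lam := lam) ht
  have h3 : √(2 * t) ^ 2 = 2 * t := Real.sq_sqrt (by positivity)
  have h4 : √(t ^ 3 / 6) ^ 2 = t ^ 3 / 6 := Real.sq_sqrt (by positivity)
  unfold noiseVariance
  have h5 : ξ * (t / lam - (1 - decay lam t) / lam ^ 2) =
      ξ / 2 * (t / 2 * (2 * (1 - decay lam t) / lam)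
        + (t * (1 + decay lam t) / lam - 2 * (1 - decay lam t) / lam ^ 2)) := by ring
  rw [h5]
  linear_combination q ^ 2 * h0 + 2 * q * r * (η + ξ * t / 4) * h1 + q * r * ξ * h2
    + r ^ 2 * (η + ξ * t / 4) ^ 2 * h3 + r ^ 2 * (ξ / 2) ^ 2 * h4

/-- The cocycle identity behind the semigroup property. -/
lemma noiseVariance_add {lam : ℝ} (hlam : 0 < lam) (ξ s t q r η : ℝ) :
    noiseVariance lam ξ (s + t) q r η =
      noiseVariance lam ξ t q r (η + ξ * s / 2)
        + noiseVariance lam ξ s (decay lam t * q) r η := by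
  unfold noiseVariance
  rw [decay_add]
  field_simp
  ring

lemma cexp_integrable {μ : Measure Space} [IsFiniteMeasure μ] (l₁ l₂ l₃ : ℝ) :
    Integrable (fun v : Space =>
      Complex.exp (((l₁ * v.1 + l₂ * v.2.1 + l₃ * v.2.2 : ℝ) : ℂ) * Complex.I)) μ := by
  refine Integrable.of_bound (C := 1) ?_ (Eventually.of_forall fun v => ?_)
  · exact Continuous.aestronglyMeasurable (by fun_prop)
  · rw [Complex.norm_exp_ofReal_mul_I]

lemma integral_cexp_solutionKernel {lam : ℝ} (hlam : 0 < lam) (ξ : ℝ) (t : ℝ≥0) (w : Space)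
    (l₁ l₂ l₃ : ℝ) :
    ∫ v, Complex.exp (((l₁ * v.1 + l₂ * v.2.1 + l₃ * v.2.2 : ℝ) : ℂ) * Complex.I)
      ∂(solutionKernel lam ξ t w) =
    Complex.exp (((l₁ * (driftFlow lam ξ t w).1 + l₂ * (driftFlow lam ξ t w).2.1
        + l₃ * (driftFlow lam ξ t w).2.2 : ℝ) : ℂ) * Complex.I) *
      Complex.exp (-((noiseVariance lam ξ t (l₁ + ξ / (2 * lam) * l₃) l₃
        (w.2.1 / 2 - ξ / (2 * lam)) : ℝ) : ℂ) / 2) := by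
  rw [solutionKernel_apply, integral_map (measurable_solution lam ξ t w).aemeasurable
    (Continuous.aestronglyMeasurable (by fun_prop)), ← noiseVariance_eq hlam t.coe_nonneg,
    ← integral_cexp_stdGauss, ← integral_const_mul]
  refine integral_congr_ae (Eventually.of_forall fun N => ?_)
  simp only [← Complex.exp_add]
  congr 1
  simp only [solution, driftFlow, noise, noiseA, noiseB, noiseC, Prod.fst_add, Prod.snd_add]
  push_cast
  ring

lemma measure_ext_of_integral_cexp {μ ν : Measure Space} [IsFiniteMeasure μ] [IsFiniteMeasure ν]
    (h : ∀ l₁ l₂ l₃ : ℝ,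
      ∫ v, Complex.exp (((l₁ * v.1 + l₂ * v.2.1 + l₃ * v.2.2 : ℝ) : ℂ) * Complex.I) ∂μ =
      ∫ v, Complex.exp (((l₁ * v.1 + l₂ * v.2.1 + l₃ * v.2.2 : ℝ) : ℂ) * Complex.I) ∂ν) :
    μ = ν := by
  refine Measure.ext_of_charFunDual (funext fun l => ?_)
  rw [charFunDual_apply, charFunDual_apply]
  have hl : ∀ v : Space, l v = l (1, 0, 0) * v.1 + l (0, 1, 0) * v.2.1 + l (0, 0, 1) * v.2.2 := by
    rintro ⟨x, y, z⟩
    have : ((x, y, z) : Space) = x • (1, 0, 0) + y • (0, 1, 0) + z • (0, 0, 1) := by simp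
    rw [this, map_add, map_add, map_smul, map_smul, map_smul]
    simp [mul_comm]
  rw [show (fun v : Space => Complex.exp ((l v : ℂ) * Complex.I)) = _ from
    funext fun v => by rw [hl v]]
  exact h _ _ _

lemma solutionKernel_zero (lam ξ : ℝ) : solutionKernel lam ξ 0 = Kernel.id := by
  ext1 w
  have h : solution lam ξ ((0 : ℝ≥0) : ℝ) w = fun _ => w := by
    funext N
    have h1 : chol₁ lam 0 = 0 := by simp [chol₁]
    have h2 : chol₂ lam 0 = 0 := by simp [chol₂]
    have h3 : chol₃ lam 0 = 0 := by simp [chol₃, h1, h2, decay_zero]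
    have hflow : driftFlow lam ξ 0 w = w := by
      ext <;> simp only [driftFlow, decay_zero] <;> ring
    have hnoise : noise lam ξ 0 w.2.1 N = 0 := by
      ext <;> simp [noise, noiseA, noiseB, noiseC, h1, h2, h3]
    rw [NNReal.coe_zero, solution, hflow, hnoise, add_zero]
  rw [solutionKernel_apply, h, Kernel.id_apply, Measure.map_const]
  simp

lemma solutionKernel_add {lam : ℝ} (hlam : 0 < lam) (ξ : ℝ) (s t : ℝ≥0) :
    solutionKernel lam ξ (s + t) = (solutionKernel lam ξ t).comp (solutionKernel lam ξ s) := by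
  ext1 w
  refine measure_ext_of_integral_cexp fun l₁ l₂ l₃ => ?_
  rw [Kernel.integral_comp (cexp_integrable l₁ l₂ l₃)]
  simp_rw [integral_cexp_solutionKernel hlam ξ t]
  have hconst : (fun v : Space => Complex.exp (((l₁ * (driftFlow lam ξ t v).1
        + l₂ * (driftFlow lam ξ t v).2.1 + l₃ * (driftFlow lam ξ t v).2.2 : ℝ) : ℂ) * Complex.I) *
      Complex.exp (-((noiseVariance lam ξ t (l₁ + ξ / (2 * lam) * l₃) l₃
        (v.2.1 / 2 - ξ / (2 * lam)) : ℝ) : ℂ) / 2)) =ᵐ[solutionKernel lam ξ s w]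
      fun v : Space => Complex.exp ((((l₁ * decay lam t - l₃ * (ξ / (2 * lam) * (1 - decay lam t)))
          * v.1 + l₂ * v.2.1 + l₃ * v.2.2 : ℝ) : ℂ) * Complex.I) *
        (Complex.exp (((l₂ * (ξ * t) : ℝ) : ℂ) * Complex.I) *
        Complex.exp (-((noiseVariance lam ξ t (l₁ + ξ / (2 * lam) * l₃) l₃
          (w.2.1 / 2 - ξ / (2 * lam) + ξ * s / 2) : ℝ) : ℂ) / 2)) := by
    -- The second coordinate is deterministic, so the variance is almost surely constant.
    have hy : ∀ᵐ v ∂(solutionKernel lam ξ s w), v.2.1 = w.2.1 + ξ * s := by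
      rw [solutionKernel_apply, ae_map_iff (measurable_solution lam ξ s w).aemeasurable
        (measurableSet_eq_fun (by fun_prop) (by fun_prop))]
      exact Eventually.of_forall fun N => solution_snd lam ξ s w N
    filter_upwards [hy] with v hv
    have hη : v.2.1 / 2 - ξ / (2 * lam) = w.2.1 / 2 - ξ / (2 * lam) + ξ * s / 2 := by
      rw [hv]; ring
    rw [hη, ← mul_assoc]
    congr 1
    rw [← Complex.exp_add]
    congr 1
    simp only [driftFlow]
    push_cast
    ring
  rw [integral_congr_ae hconst, integral_mul_const, integral_cexp_solutionKernel hlam ξ s,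
    integral_cexp_solutionKernel hlam ξ (s + t), NNReal.coe_add, noiseVariance_add hlam]
  have hq : l₁ * decay lam t - l₃ * (ξ / (2 * lam) * (1 - decay lam t)) + ξ / (2 * lam) * l₃ =
      decay lam t * (l₁ + ξ / (2 * lam) * l₃) := by ring
  rw [hq, ← Complex.exp_add, ← Complex.exp_add, ← Complex.exp_add, ← Complex.exp_add]
  congr 1
  simp only [driftFlow, decay_add]
  push_cast
  ring

/-! ### Moments of the noise -/

instance : IsGaussian stdGauss := by unfold stdGauss; infer_instance

lemma integrable_norm_pow_stdGauss (k : ℕ) : Integrable (fun N : Space => ‖N‖ ^ k) stdGauss := by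
  have := (IsGaussian.memLp_id stdGauss (k : ℝ≥0∞) (by simp)).integrable_norm_pow'
  simpa using this

/-- The coordinates of `ℝ³`, indexed by `Fin 3`. -/
def coord (i : Fin 3) (N : Space) : ℝ := ![N.1, N.2.1, N.2.2] i

lemma abs_fst_le (N : Space) : |N.1| ≤ ‖N‖ := norm_fst_le N

lemma abs_snd_fst_le (N : Space) : |N.2.1| ≤ ‖N‖ := (norm_fst_le N.2).trans (norm_snd_le N)

lemma abs_snd_snd_le (N : Space) : |N.2.2| ≤ ‖N‖ := (norm_snd_le N.2).trans (norm_snd_le N)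

lemma abs_coord_le (i : Fin 3) (N : Space) : |coord i N| ≤ ‖N‖ := by
  fin_cases i
  · exact abs_fst_le N
  · exact abs_snd_fst_le N
  · exact abs_snd_snd_le N

lemma continuous_coord (i : Fin 3) : Continuous (coord i) := by
  fin_cases i
  · exact continuous_fst
  · exact continuous_fst.comp continuous_snd
  · exact continuous_snd.comp continuous_snd

lemma integrable_coord (i : Fin 3) : Integrable (coord i) stdGauss :=
  (by simpa using integrable_norm_pow_stdGauss 1 : Integrable (fun N : Space => ‖N‖) stdGauss).mono'
    (continuous_coord i).aestronglyMeasurable (Eventually.of_forall fun N => abs_coord_le i N)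

lemma integrable_coord_mul (i j : Fin 3) :
    Integrable (fun N => coord i N * coord j N) stdGauss := by
  refine (integrable_norm_pow_stdGauss 2).mono'
    ((continuous_coord i).mul (continuous_coord j)).aestronglyMeasurable
    (Eventually.of_forall fun N => ?_)
  rw [Real.norm_eq_abs, abs_mul, sq]
  exact mul_le_mul (abs_coord_le i N) (abs_coord_le j N) (abs_nonneg _) (norm_nonneg _)

lemma integral_stdGauss_mul (f g h : ℝ → ℝ) :
    ∫ N : Space, f N.1 * (g N.2.1 * h N.2.2) ∂stdGauss =
      (∫ s, f s ∂gaussianReal 0 1) * ((∫ s, g s ∂gaussianReal 0 1) *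
        ∫ s, h s ∂gaussianReal 0 1) := by
  rw [stdGauss, integral_prod_mul f (fun p : ℝ × ℝ => g p.1 * h p.2), integral_prod_mul g h]

lemma integral_sq_gaussianReal : ∫ s : ℝ, s ^ 2 ∂gaussianReal 0 1 = 1 := by
  have h := variance_fun_id_gaussianReal (μ := 0) (v := 1)
  rw [variance_eq_integral (by fun_prop)] at h
  simpa [integral_id_gaussianReal] using h

lemma integral_coord (i : Fin 3) : ∫ N, coord i N ∂stdGauss = 0 := by
  fin_cases i
  · simpa [coord, integral_id_gaussianReal] using integral_stdGauss_mul (fun s => s) 1 1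
  · simpa [coord, integral_id_gaussianReal] using integral_stdGauss_mul 1 (fun s => s) 1
  · simpa [coord, integral_id_gaussianReal] using integral_stdGauss_mul 1 1 (fun s => s)

lemma integral_coord_mul (i j : Fin 3) :
    ∫ N, coord i N * coord j N ∂stdGauss = if i = j then 1 else 0 := by
  have h1 := integral_stdGauss_mul (fun s => s) (fun s => s) 1
  have h2 := integral_stdGauss_mul (fun s => s) 1 (fun s => s)
  have h3 := integral_stdGauss_mul 1 (fun s => s) (fun s => s)
  have h4 := integral_stdGauss_mul (fun s => s ^ 2) 1 1
  have h5 := integral_stdGauss_mul 1 (fun s => s ^ 2) 1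
  have h6 := integral_stdGauss_mul 1 1 (fun s => s ^ 2)
  simp only [integral_id_gaussianReal, integral_sq_gaussianReal, Pi.one_apply, mul_one, one_mul,
    mul_zero, integral_const, probReal_univ, smul_eq_mul] at h1 h2 h3 h4 h5 h6
  fin_cases i <;> fin_cases j
  · simpa [coord, ← sq] using h4
  · simpa [coord] using h1
  · simpa [coord] using h2
  · simpa [coord, mul_comm] using h1
  · simpa [coord, ← sq] using h5
  · simpa [coord] using h3
  · simpa [coord, mul_comm] using h2
  · simpa [coord, mul_comm] using h3
  · simpa [coord, ← sq] using h6

/-- The linear form with coefficients `p`. -/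
def linForm (p : Fin 3 → ℝ) (N : Space) : ℝ := ∑ i, p i * coord i N

lemma integrable_linForm (p : Fin 3 → ℝ) : Integrable (linForm p) stdGauss :=
  integrable_finsetSum _ fun i _ => (integrable_coord i).const_mul _

lemma integral_linForm (p : Fin 3 → ℝ) : ∫ N, linForm p N ∂stdGauss = 0 := by
  unfold linForm
  rw [integral_finsetSum _ fun i _ => (integrable_coord i).const_mul _]
  simp [integral_const_mul, integral_coord]

lemma linForm_mul (p q : Fin 3 → ℝ) (N : Space) : linForm p N * linForm q N =
    ∑ i, ∑ j, p i * q j * (coord i N * coord j N) := by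
  rw [linForm, linForm, Finset.sum_mul_sum]
  exact Finset.sum_congr rfl fun i _ => Finset.sum_congr rfl fun j _ => by ring

lemma integrable_linForm_mul (p q : Fin 3 → ℝ) :
    Integrable (fun N => linForm p N * linForm q N) stdGauss := by
  simp_rw [linForm_mul]
  exact integrable_finsetSum _ fun i _ => integrable_finsetSum _ fun j _ =>
    (integrable_coord_mul i j).const_mul _

lemma integral_linForm_mul (p q : Fin 3 → ℝ) :
    ∫ N, linForm p N * linForm q N ∂stdGauss = ∑ i, p i * q i := by
  simp_rw [linForm_mul]
  rw [integral_finsetSum _ fun i _ => integrable_finsetSum _ fun j _ =>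
    (integrable_coord_mul i j).const_mul _]
  refine Finset.sum_congr rfl fun i _ => ?_
  rw [integral_finsetSum _ fun j _ => (integrable_coord_mul i j).const_mul _]
  simp [integral_const_mul, integral_coord_mul]

/-- The coefficients of the first component of the noise. -/
noncomputable def coeffX (lam t : ℝ) : Fin 3 → ℝ := ![chol₁ lam t, chol₂ lam t, chol₃ lam t]

/-- The coefficients of the third component of the noise. -/
noncomputable def coeffZ (lam ξ t y : ℝ) : Fin 3 → ℝ :=
  ![ξ / (2 * lam) * chol₁ lam t + (y / 2 - ξ / (2 * lam) + ξ * t / 4) * √(2 * t),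
    ξ / (2 * lam) * chol₂ lam t + ξ / 2 * √(t ^ 3 / 6), ξ / (2 * lam) * chol₃ lam t]

lemma noise_eq (lam ξ t y : ℝ) (N : Space) :
    noise lam ξ t y N = (linForm (coeffX lam t) N, 0, linForm (coeffZ lam ξ t y) N) := by
  ext
  · simp [noise, noiseA, linForm, coeffX, coord, Fin.sum_univ_three]
  · rfl
  · simp [noise, noiseA, noiseB, noiseC, linForm, coeffZ, coord, Fin.sum_univ_three]
    ring

/-- The average `(1 - e^{-lam t}) / (lam t)` of the contraction factor over `[0, t]`. -/
noncomputable def meanDecay (lam t : ℝ) : ℝ := (1 - decay lam t) / (lam * t)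

lemma tendsto_meanDecay {lam : ℝ} (hlam : 0 < lam) :
    Tendsto (meanDecay lam) (𝓝[>] 0) (𝓝 1) := by
  have hd : HasDerivAt (fun t => -decay lam t / lam) 1 0 := by
    have h1 : HasDerivAt (fun t : ℝ => -(lam * t)) (-(lam * 1)) 0 :=
      ((hasDerivAt_id' (0 : ℝ)).const_mul lam).fun_neg
    have h2 := h1.exp.fun_neg.div_const lam
    refine h2.congr_deriv ?_
    rw [mul_zero, neg_zero, Real.exp_zero]
    field_simp
  have h := hd.tendsto_slope_zero_right
  refine h.congr' ?_
  filter_upwards [self_mem_nhdsWithin] with t ht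
  simp only [zero_add, decay_zero, smul_eq_mul, meanDecay]
  have : t ≠ 0 := ne_of_gt ht
  field_simp
  ring

lemma tendsto_decay (lam : ℝ) : Tendsto (decay lam) (𝓝[>] 0) (𝓝 1) := by
  have h : Continuous (decay lam) := by unfold decay; fun_prop
  have := h.tendsto 0
  rw [decay_zero] at this
  exact this.mono_left nhdsWithin_le_nhds

lemma sum_coeffX_sq {lam t : ℝ} (hlam : 0 < lam) (ht : 0 < t) :
    ∑ i, coeffX lam t i * coeffX lam t i =
      2 * t * (meanDecay lam t * (1 + decay lam t) / 2) := by
  have h := chol_sq_sum hlam ht.le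
  simp only [Fin.sum_univ_three, coeffX, Matrix.cons_val]
  rw [meanDecay, ← sq, ← sq, ← sq, h]
  field_simp
  ring

lemma sum_coeffX_mul_coeffZ {lam t : ℝ} (hlam : 0 < lam) (ht : 0 < t) (ξ y : ℝ) :
    ∑ i, coeffX lam t i * coeffZ lam ξ t y i =
      2 * t * (ξ / (2 * lam) * (meanDecay lam t * (1 + decay lam t) / 2)
        + ((y / 2 - ξ / (2 * lam)) * meanDecay lam t
          + ξ / (2 * lam) * (1 - meanDecay lam t))) := by
  have h := sum_coeffX_sq hlam ht
  have h1 := chol₁_mul hlam ht.le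
  have h2 := chol₂_mul (lam := lam) ht.le
  simp only [Fin.sum_univ_three, coeffX, coeffZ, Matrix.cons_val] at h ⊢
  have h3 : 2 * t * ((y / 2 - ξ / (2 * lam)) * meanDecay lam t
      + ξ / (2 * lam) * (1 - meanDecay lam t)) =
      (y / 2 - ξ / (2 * lam) + ξ * t / 4) * (2 * (1 - decay lam t) / lam)
        + ξ / 2 * (t * (1 + decay lam t) / lam - 2 * (1 - decay lam t) / lam ^ 2) := by
    unfold meanDecay; field_simp; ring
  linear_combination ξ / (2 * lam) * h + (y / 2 - ξ / (2 * lam) + ξ * t / 4) * h1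
    + ξ / 2 * h2 - h3

lemma sum_coeffZ_sq {lam t : ℝ} (hlam : 0 < lam) (ht : 0 < t) (ξ y : ℝ) :
    ∑ i, coeffZ lam ξ t y i * coeffZ lam ξ t y i =
      2 * t * ((ξ / (2 * lam)) ^ 2 * (meanDecay lam t * (1 + decay lam t) / 2)
        + 2 * (ξ / (2 * lam)) * ((y / 2 - ξ / (2 * lam)) * meanDecay lam t
          + ξ / (2 * lam) * (1 - meanDecay lam t))
        + ((y / 2 - ξ / (2 * lam)) ^ 2 + (y / 2 - ξ / (2 * lam)) * ξ * t / 2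
          + ξ ^ 2 * t ^ 2 / 12)) := by
  have h := sum_coeffX_sq hlam ht
  have h1 := sum_coeffX_mul_coeffZ hlam ht ξ y
  have h3 : √(2 * t) ^ 2 = 2 * t := Real.sq_sqrt (by positivity)
  have h4 : √(t ^ 3 / 6) ^ 2 = t ^ 3 / 6 := Real.sq_sqrt (by positivity)
  simp only [Fin.sum_univ_three, coeffX, coeffZ, Matrix.cons_val] at h h1 ⊢
  linear_combination (-(ξ / (2 * lam)) ^ 2) * h + 2 * (ξ / (2 * lam)) * h1
    + (y / 2 - ξ / (2 * lam) + ξ * t / 4) ^ 2 * h3 + (ξ / 2) ^ 2 * h4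

lemma abs_coeffX_le {lam t : ℝ} (hlam : 0 < lam) (ht : 0 ≤ t) :
    |chol₁ lam t| ≤ √(2 * t) ∧ |chol₂ lam t| ≤ √(2 * t) ∧ |chol₃ lam t| ≤ √(2 * t) := by
  have h := chol_sq_sum hlam ht
  have hle : (1 - decay lam t ^ 2) / lam ≤ 2 * t := by
    rw [div_le_iff₀ hlam]
    nlinarith [one_sub_decay_le lam t, decay_le_one hlam ht, decay_pos lam t]
  refine ⟨Real.abs_le_sqrt ?_, Real.abs_le_sqrt ?_, Real.abs_le_sqrt ?_⟩ <;>
    nlinarith [sq_nonneg (chol₁ lam t), sq_nonneg (chol₂ lam t), sq_nonneg (chol₃ lam t)]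

lemma abs_noiseA_le {lam t : ℝ} (hlam : 0 < lam) (ht : 0 ≤ t) (N : Space) :
    |noiseA lam t N| ≤ 3 * √(2 * t) * ‖N‖ := by
  obtain ⟨h1, h2, h3⟩ := abs_coeffX_le hlam ht
  have g1 : |chol₁ lam t * N.1| ≤ √(2 * t) * ‖N‖ := by
    rw [abs_mul]; exact mul_le_mul h1 (abs_fst_le N) (abs_nonneg _) (Real.sqrt_nonneg _)
  have g2 : |chol₂ lam t * N.2.1| ≤ √(2 * t) * ‖N‖ := by
    rw [abs_mul]; exact mul_le_mul h2 (abs_snd_fst_le N) (abs_nonneg _) (Real.sqrt_nonneg _)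
  have g3 : |chol₃ lam t * N.2.2| ≤ √(2 * t) * ‖N‖ := by
    rw [abs_mul]; exact mul_le_mul h3 (abs_snd_snd_le N) (abs_nonneg _) (Real.sqrt_nonneg _)
  have := abs_add_three (chol₁ lam t * N.1) (chol₂ lam t * N.2.1) (chol₃ lam t * N.2.2)
  unfold noiseA
  linarith

lemma abs_noiseB_le (t : ℝ) (N : Space) : |noiseB t N| ≤ √(2 * t) * ‖N‖ := by
  rw [noiseB, abs_mul, abs_of_nonneg (Real.sqrt_nonneg _)]
  exact mul_le_mul_of_nonneg_left (abs_fst_le N) (Real.sqrt_nonneg _)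

lemma abs_noiseC_le (ξ : ℝ) {t : ℝ} (ht : 0 ≤ t) (ht1 : t ≤ 1) (N : Space) :
    |noiseC ξ t N| ≤ |ξ| * √(2 * t) * ‖N‖ := by
  have g1 : |t / 2 * (√(2 * t) * N.1)| ≤ 1 * (√(2 * t) * ‖N‖) := by
    rw [abs_mul]
    refine mul_le_mul ?_ (abs_noiseB_le t N) (abs_nonneg _) zero_le_one
    rw [abs_of_nonneg (by positivity)]; linarith
  have g2 : |√(t ^ 3 / 6) * N.2.1| ≤ √(2 * t) * ‖N‖ := by
    rw [abs_mul, abs_of_nonneg (Real.sqrt_nonneg _)]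
    refine mul_le_mul (Real.sqrt_le_sqrt ?_) (abs_snd_fst_le N) (abs_nonneg _)
      (Real.sqrt_nonneg _)
    have : t ^ 3 ≤ t := by simpa using pow_le_pow_of_le_one ht ht1 (show 1 ≤ 3 by norm_num)
    linarith
  have g3 := abs_add_le (t / 2 * (√(2 * t) * N.1)) (√(t ^ 3 / 6) * N.2.1)
  rw [noiseC, abs_mul, abs_div, abs_two, mul_assoc]
  calc |ξ| / 2 * |t / 2 * (√(2 * t) * N.1) + √(t ^ 3 / 6) * N.2.1|
      ≤ |ξ| / 2 * (2 * (√(2 * t) * ‖N‖)) := by gcongr; linarith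
    _ = |ξ| * (√(2 * t) * ‖N‖) := by ring

lemma norm_noise_le {lam t : ℝ} (hlam : 0 < lam) (ht : 0 ≤ t) (ht1 : t ≤ 1) (ξ y : ℝ)
    (N : Space) : ‖noise lam ξ t y N‖ ≤
      (3 + 3 * |ξ / (2 * lam)| + |y / 2 - ξ / (2 * lam)| + |ξ|) * (√(2 * t) * ‖N‖) := by
  have hA := abs_noiseA_le hlam ht N
  have hB := abs_noiseB_le t N
  have hC := abs_noiseC_le ξ ht ht1 N
  have hu : 0 ≤ √(2 * t) * ‖N‖ := by positivity
  have h1 : |ξ / (2 * lam) * noiseA lam t N| ≤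
      |ξ / (2 * lam)| * (3 * √(2 * t) * ‖N‖) := by
    rw [abs_mul]; gcongr
  have h2 : |(y / 2 - ξ / (2 * lam)) * noiseB t N| ≤
      |y / 2 - ξ / (2 * lam)| * (√(2 * t) * ‖N‖) := by
    rw [abs_mul]; gcongr
  have h3 := abs_add_three (ξ / (2 * lam) * noiseA lam t N)
    ((y / 2 - ξ / (2 * lam)) * noiseB t N) (noiseC ξ t N)
  have e1 := mul_nonneg (abs_nonneg (ξ / (2 * lam))) hu
  have e2 := mul_nonneg (abs_nonneg (y / 2 - ξ / (2 * lam))) hu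
  have e3 := mul_nonneg (abs_nonneg ξ) hu
  refine norm_prod_le_iff.mpr ⟨?_, norm_prod_le_iff.mpr ⟨?_, ?_⟩⟩
  · simp only [noise, Real.norm_eq_abs]; nlinarith
  · simp only [noise, norm_zero]; positivity
  · simp only [noise, Real.norm_eq_abs]; nlinarith

/-! ### The generator on test functions -/

/-- The second derivative of `f` at `w` as a bilinear form. -/
noncomputable def hess (f : Space → ℝ) (w : Space) : Space →L[ℝ] Space →L[ℝ] ℝ :=
  fderiv ℝ (fderiv ℝ f) w

/-- The drift field `ξ Y - lam x ∂_x`. -/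
noncomputable def driftField (lam ξ : ℝ) (w : Space) : Space := (-(lam * w.1), ξ, -(ξ / 2 * w.1))

/-- The second order part `X² f` of the generator. -/
noncomputable def diffusionPart (f : Space → ℝ) (w : Space) : ℝ :=
  hess f w (fieldX w) (fieldX w)

/-- The first order part of the generator: the derivative along the drift field. -/
noncomputable def driftPart (lam ξ : ℝ) (f : Space → ℝ) (w : Space) : ℝ :=
  fderiv ℝ f w (driftField lam ξ w)

lemma hasDerivAt_line {E : Type*} [NormedAddCommGroup E] [NormedSpace ℝ E] (w v : E) (s : ℝ) :
    HasDerivAt (fun s : ℝ => w + s • v) v s := by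
  simpa using ((hasDerivAt_id' s).smul_const v).const_add w

lemma contDiff_fderiv {f : Space → ℝ} (hf : ContDiff ℝ ∞ f) : ContDiff ℝ ∞ (fderiv ℝ f) :=
  hf.fderiv_right (by simp)

lemma contDiff_hess {f : Space → ℝ} (hf : ContDiff ℝ ∞ f) : ContDiff ℝ ∞ (hess f) :=
  (contDiff_fderiv hf).fderiv_right (by simp)

lemma hasFDerivAt_hess {f : Space → ℝ} (hf : ContDiff ℝ ∞ f) (w : Space) :
    HasFDerivAt (fderiv ℝ f) (hess f w) w :=
  ((contDiff_fderiv hf).differentiable (by simp) w).hasFDerivAt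

lemma fderiv_eq_zero_of_notMem {f : Space → ℝ} {w : Space} (hw : w ∉ tsupport f) :
    fderiv ℝ f w = 0 :=
  image_eq_zero_of_notMem_tsupport fun h => hw (tsupport_fderiv_subset ℝ h)

lemma hess_eq_zero_of_notMem {f : Space → ℝ} {w : Space} (hw : w ∉ tsupport f) :
    hess f w = 0 :=
  image_eq_zero_of_notMem_tsupport fun h =>
    hw (tsupport_fderiv_subset ℝ (tsupport_fderiv_subset ℝ h))

lemma hasDerivAt_comp_line {f : Space → ℝ} (hf : ContDiff ℝ ∞ f) (w v : Space) (s : ℝ) :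
    HasDerivAt (fun s : ℝ => f (w + s • v)) (fderiv ℝ f (w + s • v) v) s :=
  (hf.differentiable (by simp) _).hasFDerivAt.comp_hasDerivAt s (hasDerivAt_line w v s)

lemma hasDerivAt_fderiv_comp_line {f : Space → ℝ} (hf : ContDiff ℝ ∞ f) (w v : Space) (s : ℝ) :
    HasDerivAt (fun s : ℝ => fderiv ℝ f (w + s • v)) (hess f (w + s • v) v) s :=
  (hasFDerivAt_hess hf _).comp_hasDerivAt s (hasDerivAt_line w v s)

lemma act_eq_fderiv {f : Space → ℝ} (hf : ContDiff ℝ ∞ f) (U : Space → Space) (w : Space) :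
    act U f w = fderiv ℝ f w (U w) :=
  (hf.differentiable (by simp) w).lineDeriv_eq_fderiv

lemma act_fieldX_sq {f : Space → ℝ} (hf : ContDiff ℝ ∞ f) (w : Space) :
    act fieldX (act fieldX f) w = diffusionPart f w := by
  -- The field `X` is constant along its own integral lines.
  have hX : ∀ s : ℝ, fieldX (w + s • fieldX w) = fieldX w := fun s => by
    simp [fieldX]
  have h1 : (fun s : ℝ => act fieldX f (w + s • fieldX w)) =
      fun s : ℝ => fderiv ℝ f (w + s • fieldX w) (fieldX w) := by
    funext s; rw [act_eq_fderiv hf, hX]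
  have h2 := (hasDerivAt_fderiv_comp_line hf w (fieldX w) 0).clm_apply
    (hasDerivAt_const (0 : ℝ) (fieldX w))
  rw [act, lineDeriv, h1, h2.deriv, diffusionPart]
  simp

lemma generator_eq {f : Space → ℝ} (hf : ContDiff ℝ ∞ f) (lam ξ : ℝ) (w : Space) :
    generator lam ξ f w = diffusionPart f w + driftPart lam ξ f w := by
  rw [generator, act_fieldX_sq hf, act_eq_fderiv hf, act_eq_fderiv hf, driftPart]
  have : driftField lam ξ w = ξ • fieldY w - lam • fieldD w := by
    ext <;> simp [driftField, fieldY, fieldD]; ring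
  rw [this, map_sub, map_smul, map_smul, smul_eq_mul, smul_eq_mul]
  ring

lemma continuous_fieldX : Continuous fieldX := by unfold fieldX; fun_prop

lemma continuous_driftField (lam ξ : ℝ) : Continuous (driftField lam ξ) := by
  unfold driftField; fun_prop

lemma continuous_diffusionPart {f : Space → ℝ} (hf : ContDiff ℝ ∞ f) :
    Continuous (diffusionPart f) :=
  ((contDiff_hess hf).continuous.clm_apply continuous_fieldX).clm_apply continuous_fieldX

lemma continuous_driftPart {f : Space → ℝ} (hf : ContDiff ℝ ∞ f) (lam ξ : ℝ) :
    Continuous (driftPart lam ξ f) :=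
  (contDiff_fderiv hf).continuous.clm_apply (continuous_driftField lam ξ)

lemma diffusionPart_eq_zero {f : Space → ℝ} {w : Space} (hw : w ∉ tsupport f) :
    diffusionPart f w = 0 := by simp [diffusionPart, hess_eq_zero_of_notMem hw]

lemma driftPart_eq_zero {f : Space → ℝ} {w : Space} (lam ξ : ℝ) (hw : w ∉ tsupport f) :
    driftPart lam ξ f w = 0 := by simp [driftPart, fderiv_eq_zero_of_notMem hw]

lemma exists_bound_of_eq_zero {K : Set Space} (hK : IsCompact K) {E : Type*}
    [NormedAddCommGroup E] {g : Space → E} (hg : Continuous g) (h0 : ∀ w ∉ K, g w = 0) :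
    ∃ C, 0 ≤ C ∧ ∀ w, ‖g w‖ ≤ C := by
  obtain ⟨C, hC⟩ := hK.exists_bound_of_continuousOn hg.continuousOn
  refine ⟨max C 0, le_max_right _ _, fun w => ?_⟩
  by_cases hw : w ∈ K
  · exact (hC w hw).trans (le_max_left _ _)
  · rw [h0 w hw, norm_zero]; exact le_max_right _ _

/-- Taylor's formula of second order with a remainder that is uniform in the base point. -/
lemma exists_taylor_bound {f : Space → ℝ} (hf : ContDiff ℝ ∞ f) (hc : HasCompactSupport f) :
    ∃ K, 0 ≤ K ∧ ∀ w v : Space,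
      |f (w + v) - f w - fderiv ℝ f w v - 1 / 2 * hess f w v v| ≤ K * ‖v‖ ^ 3 := by
  have hcs : HasCompactSupport (hess f) := (hc.fderiv (𝕜 := ℝ)).fderiv (𝕜 := ℝ)
  obtain ⟨K, hK⟩ : ∃ K, LipschitzWith K (hess f) :=
    ContDiff.lipschitzWith_of_hasCompactSupport (𝕂 := ℝ) (n := ∞) hcs (contDiff_hess hf) (by simp)
  have hlip : ∀ w u : Space, ‖hess f (w + u) - hess f w‖ ≤ K * ‖u‖ := fun w u => by
    simpa [hess] using hK.norm_sub_le (w + u) w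
  have hsecond : ∀ w u : Space, ‖fderiv ℝ f (w + u) - fderiv ℝ f w - hess f w u‖ ≤
      K * ‖u‖ ^ 2 := by
    intro w u
    have hd : ∀ s : ℝ, HasDerivAt (fun s : ℝ => fderiv ℝ f (w + s • u) - s • hess f w u)
        (hess f (w + s • u) u - hess f w u) s := fun s =>
      ((hasDerivAt_fderiv_comp_line hf w u s).fun_sub
        ((hasDerivAt_id' s).smul_const (hess f w u))).congr_deriv (by rw [one_smul])
    have hb : ∀ s ∈ Set.Ico (0 : ℝ) 1, ‖hess f (w + s • u) u - hess f w u‖ ≤ K * ‖u‖ ^ 2 := by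
      intro s hs
      have h1 := hlip w (s • u)
      rw [norm_smul, Real.norm_of_nonneg hs.1] at h1
      have h2 : s * ‖u‖ ≤ ‖u‖ := mul_le_of_le_one_left (norm_nonneg _) hs.2.le
      have h3 := (hess f (w + s • u) - hess f w).le_opNorm u
      calc ‖hess f (w + s • u) u - hess f w u‖
          ≤ ‖hess f (w + s • u) - hess f w‖ * ‖u‖ := h3
        _ ≤ K * ‖u‖ * ‖u‖ := by gcongr; exact h1.trans (by gcongr)
        _ = K * ‖u‖ ^ 2 := by ring
    have h := norm_image_sub_le_of_norm_deriv_le_segment_01'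
      (f := fun s : ℝ => fderiv ℝ f (w + s • u) - s • hess f w u)
      (fun s _ => (hd s).hasDerivWithinAt) hb
    simp only [one_smul, zero_smul, add_zero, sub_zero] at h
    rwa [sub_right_comm] at h
  refine ⟨K, K.2, fun w v => ?_⟩
  have hd : ∀ s : ℝ, HasDerivAt
      (fun s : ℝ => f (w + s • v) - s * fderiv ℝ f w v - s ^ 2 * (1 / 2 * hess f w v v))
      (fderiv ℝ f (w + s • v) v - 1 * fderiv ℝ f w v - (2 * s) * (1 / 2 * hess f w v v)) s :=
    fun s => ((hasDerivAt_comp_line hf w v s).sub ((hasDerivAt_id' s).mul_const _)).sub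
      ((by simpa using hasDerivAt_pow 2 s : HasDerivAt (fun s : ℝ => s ^ 2) (2 * s) s).mul_const _)
  have hb : ∀ s ∈ Set.Ico (0 : ℝ) 1, ‖fderiv ℝ f (w + s • v) v - 1 * fderiv ℝ f w v
      - (2 * s) * (1 / 2 * hess f w v v)‖ ≤ K * ‖v‖ ^ 3 := by
    intro s hs
    have h0 : fderiv ℝ f (w + s • v) v - 1 * fderiv ℝ f w v
        - (2 * s) * (1 / 2 * hess f w v v) =
        (fderiv ℝ f (w + s • v) - fderiv ℝ f w - hess f w (s • v)) v := by
      simp; ring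
    have h1 := hsecond w (s • v)
    rw [norm_smul, Real.norm_of_nonneg hs.1] at h1
    have h2 : s * ‖v‖ ≤ ‖v‖ := mul_le_of_le_one_left (norm_nonneg _) hs.2.le
    have h3 : 0 ≤ s * ‖v‖ := mul_nonneg hs.1 (norm_nonneg _)
    rw [h0]
    calc ‖(fderiv ℝ f (w + s • v) - fderiv ℝ f w - hess f w (s • v)) v‖
        ≤ ‖fderiv ℝ f (w + s • v) - fderiv ℝ f w - hess f w (s • v)‖ * ‖v‖ :=
          ContinuousLinearMap.le_opNorm _ _
      _ ≤ K * ‖v‖ ^ 2 * ‖v‖ := by gcongr; exact h1.trans (by gcongr)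
      _ = K * ‖v‖ ^ 3 := by ring
  have h := norm_image_sub_le_of_norm_deriv_le_segment_01'
    (f := fun s : ℝ => f (w + s • v) - s * fderiv ℝ f w v - s ^ 2 * (1 / 2 * hess f w v v))
    (fun s _ => (hd s).hasDerivWithinAt) hb
  rw [Real.norm_eq_abs] at h
  convert h using 2
  simp
  ring

/-! ### The flow of the drift -/

lemma driftFlow_zero (lam ξ : ℝ) (w : Space) : driftFlow lam ξ 0 w = w := by
  ext <;> simp only [driftFlow, decay_zero] <;> ring

lemma driftFlow_driftFlow (lam ξ s t : ℝ) (w : Space) :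
    driftFlow lam ξ s (driftFlow lam ξ t w) = driftFlow lam ξ (s + t) w := by
  ext <;> simp only [driftFlow, decay_add] <;> ring

lemma continuous_driftFlow (lam ξ : ℝ) :
    Continuous fun p : ℝ × Space => driftFlow lam ξ p.1 p.2 := by
  unfold driftFlow decay; fun_prop

lemma hasDerivAt_driftFlow {lam : ℝ} (hlam : 0 < lam) (ξ : ℝ) (w : Space) (t : ℝ) :
    HasDerivAt (fun t => driftFlow lam ξ t w) (driftField lam ξ (driftFlow lam ξ t w)) t := by
  have hd : HasDerivAt (decay lam) (-(lam * decay lam t)) t := by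
    have h1 : HasDerivAt (fun t : ℝ => -(lam * t)) (-(lam * 1)) t :=
      ((hasDerivAt_id' t).const_mul lam).fun_neg
    exact h1.exp.congr_deriv (by unfold decay; ring)
  refine HasDerivAt.prodMk (hd.mul_const w.1 |>.congr_deriv ?_) (HasDerivAt.prodMk
    ((((hasDerivAt_id' t).const_mul ξ).const_add w.2.1).congr_deriv ?_)
    ((((hd.const_sub 1).const_mul (ξ / (2 * lam))).mul_const w.1).const_sub w.2.2
      |>.congr_deriv ?_))
  · simp only [driftFlow]; ring
  · ring
  · simp only [driftFlow]; field_simp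

/-- Composition with the flow is strongly continuous on continuous functions of compact support. -/
lemma driftFlow_uniform (lam ξ : ℝ) {K : Set Space} (hK : IsCompact K) {g : Space → ℝ}
    (hg : Continuous g) (h0 : ∀ w ∉ K, g w = 0) {ε : ℝ} (hε : 0 < ε) :
    ∀ᶠ s in 𝓝 (0 : ℝ), ∀ w, |g (driftFlow lam ξ s w) - g w| < ε := by
  have hK' : IsCompact ((fun p : ℝ × Space => driftFlow lam ξ p.1 p.2) '' (Set.Icc (-1) 1 ×ˢ K)) :=
    (isCompact_Icc.prod hK).image (continuous_driftFlow lam ξ)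
  have h1 := hK'.eventually_forall_of_forall_eventually (x₀ := (0 : ℝ))
    (P := fun s w => |g (driftFlow lam ξ s w) - g w| < ε) (by
      intro w _
      have hcont : Continuous fun p : ℝ × Space => |g (driftFlow lam ξ p.1 p.2) - g p.2| :=
        ((hg.comp (continuous_driftFlow lam ξ)).sub (hg.comp continuous_snd)).abs
      refine (hcont.tendsto ((0 : ℝ), w)).eventually_lt_const ?_
      simpa [driftFlow_zero] using hε)
  filter_upwards [h1, Icc_mem_nhds (show (-1 : ℝ) < 0 by norm_num) zero_lt_one] with s hs hs1 w
  by_cases hw : w ∈ (fun p : ℝ × Space => driftFlow lam ξ p.1 p.2) '' (Set.Icc (-1) 1 ×ˢ K)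
  · exact hs w hw
  -- Otherwise neither `w` nor its image under the flow lies in `K`.
  have hw1 : w ∉ K := fun h => hw ⟨(0, w), ⟨⟨by norm_num, by norm_num⟩, h⟩, driftFlow_zero _ _ _⟩
  have hw2 : driftFlow lam ξ s w ∉ K := fun h => hw ⟨(-s, driftFlow lam ξ s w),
    ⟨⟨by simpa using hs1.2, by simpa using neg_le_neg hs1.1⟩, h⟩, by
      simp only [driftFlow_driftFlow, neg_add_cancel, driftFlow_zero]⟩
  rw [h0 _ hw1, h0 _ hw2]
  simpa using hε

lemma driftFlow_first_order {lam : ℝ} (hlam : 0 < lam) (ξ : ℝ) {f : Space → ℝ}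
    (hf : ContDiff ℝ ∞ f) (hc : HasCompactSupport f) {ε : ℝ} (hε : 0 < ε) :
    ∀ᶠ t in 𝓝[>] (0 : ℝ), ∀ w,
      |f (driftFlow lam ξ t w) - f w - t * driftPart lam ξ f w| ≤ ε * t := by
  have hunif := driftFlow_uniform lam ξ hc (continuous_driftPart hf lam ξ)
    (fun w hw => driftPart_eq_zero lam ξ hw) hε
  obtain ⟨δ, hδ, hball⟩ := Metric.eventually_nhds_iff.mp hunif
  filter_upwards [Ioo_mem_nhdsGT hδ] with t ht w
  have hd : ∀ s : ℝ, HasDerivAt (fun s => f (driftFlow lam ξ s w) - s * driftPart lam ξ f w)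
      (driftPart lam ξ f (driftFlow lam ξ s w) - 1 * driftPart lam ξ f w) s := fun s =>
    ((hf.differentiable (by simp) _).hasFDerivAt.comp_hasDerivAt s
      (hasDerivAt_driftFlow hlam ξ w s)).sub ((hasDerivAt_id' s).mul_const _)
  have h := norm_image_sub_le_of_norm_deriv_le_segment' (a := 0) (b := t) (C := ε)
    (fun s _ => (hd s).hasDerivWithinAt) (fun s hs => by
      rw [one_mul]
      refine (hball ?_ w).le
      rw [Real.dist_eq, sub_zero, abs_of_nonneg hs.1]
      exact hs.2.trans ht.2) t ⟨ht.1.le, le_rfl⟩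
  rw [Real.norm_eq_abs, driftFlow_zero] at h
  rw [sub_zero, zero_mul, sub_zero] at h
  rwa [sub_right_comm] at h

/-! ### The generator of the solution semigroup -/

/-- The expectation of the second order Taylor term. -/
lemma integral_hess_noise (f : Space → ℝ) (lam ξ t y : ℝ) (w : Space) :
    Integrable (fun N => hess f w (noise lam ξ t y N) (noise lam ξ t y N)) stdGauss ∧
    ∫ N, hess f w (noise lam ξ t y N) (noise lam ξ t y N) ∂stdGauss =
      hess f w (1, 0, 0) (1, 0, 0) * ∑ i, coeffX lam t i * coeffX lam t i
      + (hess f w (1, 0, 0) (0, 0, 1) + hess f w (0, 0, 1) (1, 0, 0)) *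
        ∑ i, coeffX lam t i * coeffZ lam ξ t y i
      + hess f w (0, 0, 1) (0, 0, 1) * ∑ i, coeffZ lam ξ t y i * coeffZ lam ξ t y i := by
  have hexp : (fun N => hess f w (noise lam ξ t y N) (noise lam ξ t y N)) = fun N =>
      hess f w (1, 0, 0) (1, 0, 0) * (linForm (coeffX lam t) N * linForm (coeffX lam t) N)
      + (hess f w (1, 0, 0) (0, 0, 1) + hess f w (0, 0, 1) (1, 0, 0)) *
        (linForm (coeffX lam t) N * linForm (coeffZ lam ξ t y) N)
      + hess f w (0, 0, 1) (0, 0, 1) *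
        (linForm (coeffZ lam ξ t y) N * linForm (coeffZ lam ξ t y) N) := by
    funext N
    have : noise lam ξ t y N = linForm (coeffX lam t) N • ((1, 0, 0) : Space)
        + linForm (coeffZ lam ξ t y) N • ((0, 0, 1) : Space) := by
      rw [noise_eq]; simp
    rw [this]
    simp only [map_add, map_smul, add_apply, smul_apply,
      smul_eq_mul]
    ring
  have i1 := (integrable_linForm_mul (coeffX lam t) (coeffX lam t)).const_mul
    (hess f w (1, 0, 0) (1, 0, 0))
  have i2 := (integrable_linForm_mul (coeffX lam t) (coeffZ lam ξ t y)).const_mul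
    (hess f w (1, 0, 0) (0, 0, 1) + hess f w (0, 0, 1) (1, 0, 0))
  have i3 := (integrable_linForm_mul (coeffZ lam ξ t y) (coeffZ lam ξ t y)).const_mul
    (hess f w (0, 0, 1) (0, 0, 1))
  rw [hexp]
  refine ⟨(i1.add i2).add i3, ?_⟩
  rw [integral_add (i1.fun_add i2) i3, integral_add i1 i2, integral_const_mul, integral_const_mul,
    integral_const_mul, integral_linForm_mul, integral_linForm_mul, integral_linForm_mul]

lemma integral_fderiv_noise (f : Space → ℝ) (lam ξ t y : ℝ) (w : Space) :
    Integrable (fun N => fderiv ℝ f w (noise lam ξ t y N)) stdGauss ∧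
    ∫ N, fderiv ℝ f w (noise lam ξ t y N) ∂stdGauss = 0 := by
  have hexp : (fun N => fderiv ℝ f w (noise lam ξ t y N)) = fun N =>
      fderiv ℝ f w (1, 0, 0) * linForm (coeffX lam t) N
        + fderiv ℝ f w (0, 0, 1) * linForm (coeffZ lam ξ t y) N := by
    funext N
    have : noise lam ξ t y N = linForm (coeffX lam t) N • ((1, 0, 0) : Space)
        + linForm (coeffZ lam ξ t y) N • ((0, 0, 1) : Space) := by
      rw [noise_eq]; simp
    rw [this]
    simp only [map_add, map_smul, smul_eq_mul]
    ring
  have i1 := (integrable_linForm (coeffX lam t)).const_mul (fderiv ℝ f w (1, 0, 0))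
  have i2 := (integrable_linForm (coeffZ lam ξ t y)).const_mul (fderiv ℝ f w (0, 0, 1))
  rw [hexp]
  refine ⟨i1.add i2, ?_⟩
  rw [integral_add i1 i2, integral_const_mul, integral_const_mul, integral_linForm,
    integral_linForm, mul_zero, mul_zero, add_zero]

lemma diffusionPart_eq (f : Space → ℝ) (w : Space) :
    diffusionPart f w = hess f w (1, 0, 0) (1, 0, 0)
      + w.2.1 / 2 * (hess f w (1, 0, 0) (0, 0, 1) + hess f w (0, 0, 1) (1, 0, 0))
      + (w.2.1 / 2) ^ 2 * hess f w (0, 0, 1) (0, 0, 1) := by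
  have : fieldX w = ((1, 0, 0) : Space) + (w.2.1 / 2) • ((0, 0, 1) : Space) := by
    simp [fieldX]
  rw [diffusionPart, this]
  simp only [map_add, map_smul, add_apply, smul_apply,
    smul_eq_mul]
  ring

/-- The expectation of the second order Taylor term, divided by `t`, converges to `X² f`,
uniformly in the point reached by the flow of the drift. -/
lemma second_order_uniform {lam : ℝ} (hlam : 0 < lam) (ξ : ℝ) {f : Space → ℝ}
    (hf : ContDiff ℝ ∞ f) (hc : HasCompactSupport f) {ε : ℝ} (hε : 0 < ε) :
    ∀ᶠ t in 𝓝[>] (0 : ℝ), ∀ w : Space,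
      |1 / 2 * ∫ N, hess f w (noise lam ξ t (w.2.1 - ξ * t) N) (noise lam ξ t (w.2.1 - ξ * t) N)
        ∂stdGauss - t * diffusionPart f w| ≤ ε * t := by
  -- The covariances are polynomials in `t`, `meanDecay` and `decay`; regarding these three as
  -- independent variables, the difference is continuous and vanishes at `(0, 1, 1)`.
  set c := ξ / (2 * lam)
  let η : ℝ → Space → ℝ := fun t w => (w.2.1 - ξ * t) / 2 - c
  let Ψ : (ℝ × ℝ × ℝ) × Space → ℝ := fun p =>
    hess f p.2 (1, 0, 0) (1, 0, 0) * (p.1.2.1 * (1 + p.1.2.2) / 2)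
      + (hess f p.2 (1, 0, 0) (0, 0, 1) + hess f p.2 (0, 0, 1) (1, 0, 0)) *
        (c * (p.1.2.1 * (1 + p.1.2.2) / 2) + (η p.1.1 p.2 * p.1.2.1 + c * (1 - p.1.2.1)))
      + hess f p.2 (0, 0, 1) (0, 0, 1) * (c ^ 2 * (p.1.2.1 * (1 + p.1.2.2) / 2)
        + 2 * c * (η p.1.1 p.2 * p.1.2.1 + c * (1 - p.1.2.1))
        + (η p.1.1 p.2 ^ 2 + η p.1.1 p.2 * ξ * p.1.1 / 2 + ξ ^ 2 * p.1.1 ^ 2 / 12))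
      - diffusionPart f p.2
  have hH : ∀ u v : Space, Continuous fun p : (ℝ × ℝ × ℝ) × Space => hess f p.2 u v := fun u v =>
    (((contDiff_hess hf).continuous.comp continuous_snd).clm_apply continuous_const).clm_apply
      continuous_const
  have hη : Continuous fun p : (ℝ × ℝ × ℝ) × Space => η p.1.1 p.2 := by fun_prop
  have hΨ : Continuous Ψ := by
    have h1 := hH (1, 0, 0) (1, 0, 0)
    have h2 := hH (1, 0, 0) (0, 0, 1)
    have h3 := hH (0, 0, 1) (1, 0, 0)
    have h4 := hH (0, 0, 1) (0, 0, 1)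
    have h5 := (continuous_diffusionPart hf).comp
      (continuous_snd : Continuous (Prod.snd : (ℝ × ℝ × ℝ) × Space → Space))
    exact ((((h1.mul (by fun_prop)).add ((h2.add h3).mul (by fun_prop))).add
      (h4.mul (by fun_prop))).sub h5)
  have hzero : ∀ w, Ψ ((0, 1, 1), w) = 0 := fun w => by
    simp only [Ψ, η, diffusionPart_eq]; ring
  have hev := hc.isCompact.eventually_forall_of_forall_eventually (x₀ := ((0, 1, 1) : ℝ × ℝ × ℝ))
    (P := fun q w => |Ψ (q, w)| < ε) (fun w _ =>
      (hΨ.abs.tendsto ((0, 1, 1), w)).eventually_lt_const (by rw [hzero]; simpa using hε))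
  have hlim : Tendsto (fun t => (t, meanDecay lam t, decay lam t)) (𝓝[>] 0)
      (𝓝 ((0, 1, 1) : ℝ × ℝ × ℝ)) :=
    (tendsto_id.mono_left nhdsWithin_le_nhds).prodMk_nhds
      ((tendsto_meanDecay hlam).prodMk_nhds (tendsto_decay lam))
  filter_upwards [hlim.eventually hev, self_mem_nhdsWithin] with t ht ht0 w
  rw [Set.mem_Ioi] at ht0
  by_cases hw : w ∈ tsupport f
  · have h := (ht w hw).le
    rw [(integral_hess_noise f lam ξ t _ w).2, sum_coeffX_sq hlam ht0,
      sum_coeffX_mul_coeffZ hlam ht0, sum_coeffZ_sq hlam ht0]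
    have e : ∀ a : ℝ, a = t * Ψ ((t, meanDecay lam t, decay lam t), w) → |a| ≤ ε * t := by
      rintro a rfl
      rw [abs_mul, abs_of_pos ht0, mul_comm ε]
      gcongr
    apply e
    simp only [Ψ, η, c]
    ring
  · simp only [hess_eq_zero_of_notMem hw, diffusionPart_eq_zero hw]
    simpa using mul_nonneg hε.le ht0.le

lemma continuous_noise (lam ξ t y : ℝ) : Continuous (noise lam ξ t y) := by
  unfold noise noiseA noiseB noiseC; fun_prop

lemma integrable_comp_noise {f : Space → ℝ} (hf : Continuous f) (hc : HasCompactSupport f)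
    (lam ξ t y : ℝ) (w : Space) : Integrable (fun N => f (w + noise lam ξ t y N)) stdGauss := by
  obtain ⟨C, -, hC⟩ := exists_bound_of_eq_zero hc.isCompact hf
    fun w hw => image_eq_zero_of_notMem_tsupport hw
  refine Integrable.of_bound (C := C) ?_ (Eventually.of_forall fun N => hC _)
  exact (hf.comp (continuous_const.add (continuous_noise lam ξ t y))).aestronglyMeasurable

/-- The Taylor remainder of the noise is of order `t ^ (3 / 2)`, uniformly in the starting point.
The noise in `z` grows with `|y|`, but `f` vanishes for large `|y|` and the noise does not change
`y`. -/
lemma exists_remainder_bound {lam : ℝ} (hlam : 0 < lam) (ξ : ℝ) {f : Space → ℝ}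
    (hf : ContDiff ℝ ∞ f) (hc : HasCompactSupport f) :
    ∃ C, ∀ t, 0 < t → t ≤ 1 → ∀ w : Space,
      |∫ N, f (w + noise lam ξ t (w.2.1 - ξ * t) N) ∂stdGauss - f w -
        1 / 2 * ∫ N, hess f w (noise lam ξ t (w.2.1 - ξ * t) N) (noise lam ξ t (w.2.1 - ξ * t) N)
          ∂stdGauss| ≤ C * √(2 * t) ^ 3 := by
  obtain ⟨K, hK0, hK⟩ := exists_taylor_bound hf hc
  obtain ⟨R, hR⟩ := hc.isCompact.isBounded.exists_norm_le
  set c := ξ / (2 * lam) with hcdef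
  set M := 3 + 3 * |c| + ((R + |ξ|) / 2 + |c|) + |ξ| with hM
  have hE : 0 ≤ ∫ N : Space, ‖N‖ ^ 3 ∂stdGauss := integral_nonneg fun N => by positivity
  refine ⟨|K * M ^ 3 * ∫ N : Space, ‖N‖ ^ 3 ∂stdGauss|, fun t ht ht1 w => ?_⟩
  by_cases hw : |w.2.1| ≤ R
  · have hR0 : 0 ≤ R := (abs_nonneg _).trans hw
    have hM0 : 0 ≤ M := by positivity
    have hv : ∀ N, ‖noise lam ξ t (w.2.1 - ξ * t) N‖ ≤ M * (√(2 * t) * ‖N‖) := by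
      intro N
      refine (norm_noise_le hlam ht.le ht1 ξ _ N).trans ?_
      have h1 : |(w.2.1 - ξ * t) / 2 - c| ≤ (R + |ξ|) / 2 + |c| := by
        refine (abs_sub _ _).trans ?_
        rw [abs_div, abs_two]
        have h2 : |w.2.1 - ξ * t| ≤ R + |ξ| := by
          refine (abs_sub _ _).trans (add_le_add hw ?_)
          rw [abs_mul, abs_of_pos ht]
          exact mul_le_of_le_one_right (abs_nonneg _) ht1
        linarith
      have h0 : 0 ≤ √(2 * t) * ‖N‖ := by positivity
      exact mul_le_mul_of_nonneg_right (by rw [hM]; linarith) h0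
    obtain ⟨i2, -⟩ := integral_hess_noise f lam ξ t (w.2.1 - ξ * t) w
    obtain ⟨i1, e1⟩ := integral_fderiv_noise f lam ξ t (w.2.1 - ξ * t) w
    have i0 := integrable_comp_noise hf.continuous hc lam ξ t (w.2.1 - ξ * t) w
    have heq : ∫ N, f (w + noise lam ξ t (w.2.1 - ξ * t) N) ∂stdGauss - f w -
        1 / 2 * ∫ N, hess f w (noise lam ξ t (w.2.1 - ξ * t) N) (noise lam ξ t (w.2.1 - ξ * t) N)
          ∂stdGauss =
        ∫ N, (f (w + noise lam ξ t (w.2.1 - ξ * t) N) - f w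
          - fderiv ℝ f w (noise lam ξ t (w.2.1 - ξ * t) N)
          - 1 / 2 * hess f w (noise lam ξ t (w.2.1 - ξ * t) N)
            (noise lam ξ t (w.2.1 - ξ * t) N)) ∂stdGauss := by
      have i01 : Integrable
          (fun N => f (w + noise lam ξ t (w.2.1 - ξ * t) N) - f w) stdGauss :=
        i0.sub (integrable_const _)
      have i012 : Integrable (fun N => f (w + noise lam ξ t (w.2.1 - ξ * t) N) - f w
          - fderiv ℝ f w (noise lam ξ t (w.2.1 - ξ * t) N)) stdGauss := i01.sub i1
      rw [integral_sub i012 (i2.const_mul _), integral_sub i01 i1,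
        integral_sub i0 (integrable_const _), e1,
        integral_const_mul]
      simp
    rw [heq, ← Real.norm_eq_abs]
    have hbound : ∀ N, ‖f (w + noise lam ξ t (w.2.1 - ξ * t) N) - f w
          - fderiv ℝ f w (noise lam ξ t (w.2.1 - ξ * t) N)
          - 1 / 2 * hess f w (noise lam ξ t (w.2.1 - ξ * t) N)
            (noise lam ξ t (w.2.1 - ξ * t) N)‖ ≤ K * M ^ 3 * √(2 * t) ^ 3 * ‖N‖ ^ 3 := by
      intro N
      refine (hK w _).trans ?_
      calc K * ‖noise lam ξ t (w.2.1 - ξ * t) N‖ ^ 3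
          ≤ K * (M * (√(2 * t) * ‖N‖)) ^ 3 := by gcongr; exact hv N
        _ = _ := by ring
    refine (norm_integral_le_of_norm_le ((integrable_norm_pow_stdGauss 3).const_mul _)
      (Eventually.of_forall hbound)).trans ?_
    rw [integral_const_mul, abs_of_nonneg (by positivity)]
    exact le_of_eq (by ring)
  · have hout : ∀ v : Space, v.2.1 = w.2.1 → v ∉ tsupport f := fun v hv h => by
      have := (abs_snd_fst_le v).trans (hR v h)
      rw [hv] at this
      exact hw this
    have h0 : ∀ N, f (w + noise lam ξ t (w.2.1 - ξ * t) N) = 0 := fun N =>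
      image_eq_zero_of_notMem_tsupport (hout _ (add_zero _))
    simp only [h0, image_eq_zero_of_notMem_tsupport (hout w rfl),
      hess_eq_zero_of_notMem (hout w rfl)]
    simp only [integral_zero, sub_self, zero_apply, mul_zero, abs_zero]
    positivity

lemma solution_eq (lam ξ t : ℝ) (w N : Space) : solution lam ξ t w N =
    driftFlow lam ξ t w + noise lam ξ t ((driftFlow lam ξ t w).2.1 - ξ * t) N := by
  rw [solution]; simp [driftFlow]

/-- The increment splits into the Taylor remainder of the noise, the second order term of the noise,
which yields `X² f` at the point reached by the drift flow, and the increment along that flow. -/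
lemma solution_first_order {lam : ℝ} (hlam : 0 < lam) (ξ : ℝ) {f : Space → ℝ}
    (hf : ContDiff ℝ ∞ f) (hc : HasCompactSupport f) {ε : ℝ} (hε : 0 < ε) :
    ∀ᶠ t in 𝓝[>] (0 : ℝ), ∀ w,
      |∫ N, f (solution lam ξ t w N) ∂stdGauss - f w - t * generator lam ξ f w| ≤
        4 * ε * t := by
  obtain ⟨C, hC⟩ := exists_remainder_bound hlam ξ hf hc
  have hsmall : ∀ᶠ t in 𝓝[>] (0 : ℝ), C * (2 * √(2 * t)) < ε := by
    have hcont : Continuous fun t : ℝ => C * (2 * √(2 * t)) := by fun_prop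
    have := hcont.tendsto 0
    simp only [mul_zero, Real.sqrt_zero] at this
    exact (this.mono_left nhdsWithin_le_nhds).eventually_lt_const hε
  filter_upwards [hsmall, second_order_uniform hlam ξ hf hc hε,
    driftFlow_first_order hlam ξ hf hc hε,
    nhdsWithin_le_nhds (driftFlow_uniform lam ξ hc (continuous_diffusionPart hf)
      (fun w hw => diffusionPart_eq_zero hw) hε),
    Ioo_mem_nhdsGT (zero_lt_one' ℝ)] with t h1 h2 h3 h4 ht w
  have g1 := hC t ht.1 ht.2.le (driftFlow lam ξ t w)
  simp_rw [← solution_eq] at g1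
  have g2 := h2 (driftFlow lam ξ t w)
  have g3 := h3 w
  have g4 := h4 w
  have g5 : C * √(2 * t) ^ 3 ≤ ε * t := by
    have : √(2 * t) ^ 3 = √(2 * t) * (2 * t) := by
      rw [pow_succ', Real.sq_sqrt (by linarith [ht.1])]
    rw [this]
    nlinarith [ht.1]
  have g6 : |t * (diffusionPart f (driftFlow lam ξ t w) - diffusionPart f w)| ≤ ε * t := by
    rw [abs_mul, abs_of_pos ht.1, mul_comm ε]
    exact mul_le_mul_of_nonneg_left g4.le ht.1.le
  rw [generator_eq hf]
  rw [abs_le] at g1 g2 g3 g6 ⊢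
  constructor <;> linarith [g1.1, g1.2, g2.1, g2.2, g3.1, g3.2, g6.1, g6.2]

lemma tendsto_coe_nhdsGT : Tendsto (fun t : ℝ≥0 => (t : ℝ)) (𝓝[>] 0) (𝓝[>] 0) := by
  refine tendsto_nhdsWithin_iff.mpr ⟨?_, ?_⟩
  · exact (NNReal.continuous_coe.tendsto 0).mono_left nhdsWithin_le_nhds
  · filter_upwards [self_mem_nhdsWithin] with t ht using NNReal.coe_pos.mpr ht

theorem isMarkovSemigroupGeneratedBy_solutionKernel {lam : ℝ} (hlam : 0 < lam) (ξ : ℝ) :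
    IsMarkovSemigroupGeneratedBy (generator lam ξ) (solutionKernel lam ξ) where
  markov t := inferInstance
  zero := solutionKernel_zero lam ξ
  add := solutionKernel_add hlam ξ
  infinitesimal f hf hc := by
    rw [Metric.tendstoUniformly_iff]
    intro ε hε
    filter_upwards [tendsto_coe_nhdsGT.eventually
      (solution_first_order hlam ξ hf hc (show 0 < ε / 8 by positivity)),
      self_mem_nhdsWithin] with t ht ht0 w
    have ht0' : (0 : ℝ) < t := NNReal.coe_pos.mpr ht0
    have h := ht w
    rw [semigroupAct_solutionKernel lam ξ t hf.continuous.measurable, dist_comm, Real.dist_eq]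
    have e : (∫ N, f (solution lam ξ t w N) ∂stdGauss - f w) / t - generator lam ξ f w =
        (∫ N, f (solution lam ξ t w N) ∂stdGauss - f w - t * generator lam ξ f w) / t := by
      field_simp
    rw [e, abs_div, abs_of_pos ht0', div_lt_iff₀ ht0']
    refine h.trans_lt ?_
    have := mul_pos hε ht0'
    linarith

/-! ### Uniqueness of the semigroup -/

section Semigroup

lemma integrable_of_bounded {μ : Measure Space} [IsFiniteMeasure μ] {g : Space → ℝ} {C : ℝ}
    (hg : Measurable g) (hC : ∀ w, |g w| ≤ C) : Integrable g μ :=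
  Integrable.of_bound hg.aestronglyMeasurable C (Eventually.of_forall hC)

lemma abs_integral_le_of_bounded {μ : Measure Space} [IsProbabilityMeasure μ] {g : Space → ℝ}
    {C : ℝ} (hC : ∀ w, |g w| ≤ C) : |∫ w, g w ∂μ| ≤ C := by
  simpa using norm_integral_le_of_norm_le_const (μ := μ) (f := g) (C := C)
    (Eventually.of_forall fun w => hC w)

variable {L : (Space → ℝ) → Space → ℝ} {Q : ℝ≥0 → Kernel Space Space}

lemma abs_semigroupAct_le (hQ : IsMarkovSemigroupGeneratedBy L Q) {g : Space → ℝ} {C : ℝ}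
    (hC : ∀ w, |g w| ≤ C) (t : ℝ≥0) (w : Space) : |semigroupAct Q t g w| ≤ C := by
  have := hQ.markov t
  exact abs_integral_le_of_bounded hC

lemma measurable_semigroupAct (hQ : IsMarkovSemigroupGeneratedBy L Q) {g : Space → ℝ}
    (hg : Measurable g) (t : ℝ≥0) : Measurable (semigroupAct Q t g) := by
  have := hQ.markov t
  exact (hg.stronglyMeasurable.integral_kernel (κ := Q t)).measurable

lemma semigroupAct_add (hQ : IsMarkovSemigroupGeneratedBy L Q) {g : Space → ℝ} {C : ℝ}
    (hg : Measurable g) (hC : ∀ w, |g w| ≤ C) (s t : ℝ≥0) (w : Space) :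
    semigroupAct Q (s + t) g w = semigroupAct Q s (semigroupAct Q t g) w := by
  have := hQ.markov s
  have := hQ.markov t
  simp only [semigroupAct]
  rw [hQ.add, Kernel.integral_comp (integrable_of_bounded hg hC)]

lemma semigroupAct_sub (hQ : IsMarkovSemigroupGeneratedBy L Q) {g₁ g₂ : Space → ℝ} {C₁ C₂ : ℝ}
    (hg₁ : Measurable g₁) (hC₁ : ∀ w, |g₁ w| ≤ C₁) (hg₂ : Measurable g₂) (hC₂ : ∀ w, |g₂ w| ≤ C₂)
    (t : ℝ≥0) (w : Space) :
    semigroupAct Q t (fun w => g₁ w - g₂ w) w = semigroupAct Q t g₁ w - semigroupAct Q t g₂ w := by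
  have := hQ.markov t
  exact integral_sub (integrable_of_bounded hg₁ hC₁) (integrable_of_bounded hg₂ hC₂)

lemma exists_bound_test {f : Space → ℝ} (hf : Continuous f) (hc : HasCompactSupport f) :
    ∃ C, 0 ≤ C ∧ ∀ w, |f w| ≤ C :=
  exists_bound_of_eq_zero hc.isCompact hf fun _ hw => image_eq_zero_of_notMem_tsupport hw

/-- A test function moves under the semigroup at most at the speed `sup |L f|`. -/
lemma abs_semigroupAct_sub_le (hQ : IsMarkovSemigroupGeneratedBy L Q) {f : Space → ℝ}
    (hf : ContDiff ℝ ∞ f) (hc : HasCompactSupport f) {M : ℝ} (hM : ∀ w, |L f w| ≤ M)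
    (t : ℝ≥0) (w : Space) : |semigroupAct Q t f w - f w| ≤ M * t := by
  obtain ⟨C, -, hC⟩ := exists_bound_test hf.continuous hc
  have hfm := hf.continuous.measurable
  refine le_of_forall_pos_le_add fun ε hε => ?_
  set ε' := ε / (t + 1) with hε'
  have ht1 : (0 : ℝ) < t + 1 := by positivity
  have hε'0 : 0 < ε' := div_pos hε ht1
  have h1 := Metric.tendstoUniformly_iff.mp (hQ.infinitesimal f hf hc) ε' hε'0
  obtain ⟨δ, hδ, hball⟩ := Metric.eventually_nhds_iff.mp (eventually_nhdsWithin_iff.mp h1)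
  -- Short times: the difference quotient is within `ε'` of `L f`.
  have hshort : ∀ h : ℝ≥0, (h : ℝ) < δ → ∀ w, |semigroupAct Q h f w - f w| ≤ (M + ε') * h := by
    intro h hh w
    rcases eq_or_ne h 0 with rfl | h0
    · simp [semigroupAct, hQ.zero, Kernel.id_apply, integral_dirac]
    · replace h0 : 0 < h := pos_iff_ne_zero.mpr h0
      have h0' : (0 : ℝ) < h := h0
      have h2 := hball (y := h) (by simpa [NNReal.dist_eq] using hh) h0 w
      rw [dist_comm, Real.dist_eq] at h2
      have h3 : |(semigroupAct Q h f w - f w) / h| ≤ M + ε' := by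
        have := abs_sub_abs_le_abs_sub ((semigroupAct Q h f w - f w) / h) (L f w)
        linarith [hM w]
      rwa [abs_div, abs_of_pos h0', div_le_iff₀ h0'] at h3
  have hiter : ∀ h : ℝ≥0, (h : ℝ) < δ → ∀ (n : ℕ) w,
      |semigroupAct Q (n * h) f w - f w| ≤ n * ((M + ε') * h) := by
    intro h hh n
    induction n with
    | zero => intro w; simp [semigroupAct, hQ.zero, Kernel.id_apply, integral_dirac]
    | succ n ih =>
      intro w
      have hadd : ((n + 1 : ℕ) : ℝ≥0) * h = n * h + h := by push_cast; ring
      rw [hadd, semigroupAct_add hQ hfm hC]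
      have h3 := abs_semigroupAct_le hQ (hshort h hh) (n * h) w
      rw [semigroupAct_sub hQ (measurable_semigroupAct hQ hfm h)
        (abs_semigroupAct_le hQ hC h) hfm hC] at h3
      have h4 := abs_sub_le (semigroupAct Q (n * h) (semigroupAct Q h f) w)
        (semigroupAct Q (n * h) f w) (f w)
      push_cast
      linarith [ih w]
  obtain ⟨n, hn⟩ := exists_nat_gt ((t : ℝ) / δ)
  have hn0 : (0 : ℝ) < n := lt_of_le_of_lt (by positivity) hn
  have hn0' : (n : ℝ≥0) ≠ 0 := by exact_mod_cast hn0.ne'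
  have h5 := hiter (t / n) (by
    rw [NNReal.coe_div, NNReal.coe_natCast, div_lt_iff₀ hn0]
    rwa [div_lt_iff₀ hδ, mul_comm] at hn) n w
  rw [mul_div_cancel₀ _ hn0'] at h5
  refine h5.trans ?_
  rw [NNReal.coe_div, NNReal.coe_natCast]
  have h6 : (n : ℝ) * ((M + ε') * (t / n)) = M * t + ε' * t := by field_simp
  have h7 : ε' * t ≤ ε := by
    rw [hε', div_mul_eq_mul_div, div_le_iff₀ ht1]
    nlinarith
  linarith

end Semigroup

/-! ### Test functions composed with the solution map -/

/-- The linear part of `w ↦ solution lam ξ t w N`. -/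
noncomputable def solutionLin (lam ξ t : ℝ) (N u : Space) : Space :=
  (decay lam t * u.1, u.2.1,
    u.2.2 - ξ / (2 * lam) * (1 - decay lam t) * u.1 + u.2.1 / 2 * noiseB t N)

lemma solution_add_smul (lam ξ t : ℝ) (w N u : Space) (s : ℝ) :
    solution lam ξ t (w + s • u) N = solution lam ξ t w N + s • solutionLin lam ξ t N u := by
  ext <;> simp [solution, driftFlow, noise, solutionLin] <;> ring

lemma contDiff_comp_solution {f : Space → ℝ} (hf : ContDiff ℝ ∞ f) (lam ξ t : ℝ) (N : Space) :
    ContDiff ℝ ∞ fun w => f (solution lam ξ t w N) := by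
  refine hf.comp ?_
  unfold solution driftFlow noise
  fun_prop

/-- For fixed noise the solution map is an affine bijection of `ℝ³`. -/
lemma exists_leftInverse_solution (lam ξ t : ℝ) (N : Space) :
    ∃ g : Space → Space, Continuous g ∧ ∀ w, g (solution lam ξ t w N) = w := by
  refine ⟨fun u => ((u.1 - noiseA lam t N) / decay lam t, u.2.1 - ξ * t,
    u.2.2 + ξ / (2 * lam) * (1 - decay lam t) * ((u.1 - noiseA lam t N) / decay lam t)
      - ξ / (2 * lam) * noiseA lam t N
      - ((u.2.1 - ξ * t) / 2 - ξ / (2 * lam)) * noiseB t N - noiseC ξ t N), ?_, fun w => ?_⟩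
  · fun_prop
  · have hd := (decay_pos lam t).ne'
    have h1 : (decay lam t * w.1 + noiseA lam t N - noiseA lam t N) / decay lam t = w.1 := by
      field_simp; ring
    ext <;> simp only [solution, driftFlow, noise, Prod.fst_add, Prod.snd_add, h1] <;> ring

lemma hasCompactSupport_comp_solution {f : Space → ℝ} (hc : HasCompactSupport f)
    (lam ξ t : ℝ) (N : Space) : HasCompactSupport fun w => f (solution lam ξ t w N) := by
  obtain ⟨g, hg, hgs⟩ := exists_leftInverse_solution lam ξ t N
  refine HasCompactSupport.intro (hc.isCompact.image hg) fun w hw => ?_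
  by_contra h
  exact hw ⟨_, subset_tsupport _ h, hgs w⟩

lemma fderiv_comp_solution {f : Space → ℝ} (hf : ContDiff ℝ ∞ f) (lam ξ t : ℝ) (w N u : Space) :
    fderiv ℝ (fun w => f (solution lam ξ t w N)) w u =
      fderiv ℝ f (solution lam ξ t w N) (solutionLin lam ξ t N u) := by
  have h1 := hasDerivAt_comp_line (contDiff_comp_solution hf lam ξ t N) w u 0
  have h2 := hasDerivAt_comp_line hf (solution lam ξ t w N) (solutionLin lam ξ t N u) 0
  simp only [solution_add_smul] at h1
  simpa using h1.unique h2

lemma hess_comp_solution {f : Space → ℝ} (hf : ContDiff ℝ ∞ f) (lam ξ t : ℝ) (w N u : Space) :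
    hess (fun w => f (solution lam ξ t w N)) w u u =
      hess f (solution lam ξ t w N) (solutionLin lam ξ t N u) (solutionLin lam ξ t N u) := by
  have h1 := (hasDerivAt_fderiv_comp_line (contDiff_comp_solution hf lam ξ t N) w u 0).clm_apply
    (hasDerivAt_const (0 : ℝ) u)
  have h2 := (hasDerivAt_fderiv_comp_line hf (solution lam ξ t w N)
    (solutionLin lam ξ t N u) 0).clm_apply (hasDerivAt_const (0 : ℝ) (solutionLin lam ξ t N u))
  simp only [fderiv_comp_solution hf, solution_add_smul] at h1
  have h0 : solutionLin lam ξ t N 0 = 0 := by simp [solutionLin]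
  simpa [h0] using h1.unique h2

/-- The generator of the composition of a test function with the solution map grows at most
linearly in the noise. -/
lemma exists_generator_comp_solution_bound {lam : ℝ} (hlam : 0 < lam) (ξ : ℝ) {f : Space → ℝ}
    (hf : ContDiff ℝ ∞ f) (hc : HasCompactSupport f) (T : ℝ) :
    ∃ C, 0 ≤ C ∧ ∀ t, 0 ≤ t → t ≤ T → ∀ w N : Space,
      |generator lam ξ (fun w => f (solution lam ξ t w N)) w| ≤ C * (1 + ‖N‖) := by
  obtain ⟨F₁, hF₁0, hF₁⟩ := exists_bound_of_eq_zero hc.isCompact (contDiff_fderiv hf).continuous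
    fun w hw => fderiv_eq_zero_of_notMem hw
  obtain ⟨F₂, hF₂0, hF₂⟩ := exists_bound_of_eq_zero hc.isCompact (contDiff_hess hf).continuous
    fun w hw => hess_eq_zero_of_notMem hw
  obtain ⟨R', hR'⟩ := hc.isCompact.isBounded.exists_norm_le
  set R := |R'| with hR
  set b := 1 + (R + |ξ| * |T|) / 2 + |ξ / (2 * lam)| with hb
  set τ := √(2 * T) with hτ
  have hτ0 : 0 ≤ τ := Real.sqrt_nonneg _
  have hb0 : 0 ≤ b := by positivity
  set d := (lam + |ξ|) * (R + 3 * τ) + |ξ| + |ξ| * τ with hd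
  have hd0 : 0 ≤ d := by positivity
  refine ⟨F₂ * b * b + F₁ * d, by positivity, fun t ht htT w N => ?_⟩
  have hN1 : 1 ≤ 1 + ‖N‖ := by linarith [norm_nonneg N]
  rw [generator_eq (contDiff_comp_solution hf lam ξ t N), diffusionPart, driftPart,
    hess_comp_solution hf, fderiv_comp_solution hf]
  set v := solution lam ξ t w N with hv
  by_cases hvs : v ∈ tsupport f
  swap
  · rw [fderiv_eq_zero_of_notMem hvs, hess_eq_zero_of_notMem hvs]
    simp only [zero_apply, add_zero, abs_zero]
    positivity
  have hvR : ‖v‖ ≤ R := (hR' v hvs).trans (le_abs_self _)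
  have hT : 0 ≤ T := ht.trans htT
  have hsq : √(2 * t) ≤ τ := Real.sqrt_le_sqrt (by linarith)
  have hA : |noiseA lam t N| ≤ 3 * τ * ‖N‖ :=
    (abs_noiseA_le hlam ht N).trans (by gcongr)
  have hB : |noiseB t N| ≤ τ * ‖N‖ := (abs_noiseB_le t N).trans (by gcongr)
  have he0 := decay_pos lam t
  have he1 := decay_le_one hlam ht
  have hy : |w.2.1| ≤ R + |ξ| * |T| := by
    have h1 : w.2.1 = v.2.1 - ξ * t := by rw [hv, solution_snd]; ring
    rw [h1]
    refine (abs_sub _ _).trans (add_le_add ((abs_snd_fst_le v).trans hvR) ?_)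
    rw [abs_mul, abs_of_nonneg ht, abs_of_nonneg hT]
    gcongr
  have hx : |decay lam t * w.1| ≤ R + 3 * τ * ‖N‖ := by
    have h1 : decay lam t * w.1 = v.1 - noiseA lam t N := by rw [hv, solution_fst]; ring
    rw [h1]
    exact (abs_sub _ _).trans (add_le_add ((abs_fst_le v).trans hvR) hA)
  have hX : ‖solutionLin lam ξ t N (fieldX w)‖ ≤ b := by
    have hR0 : 0 ≤ R := abs_nonneg _
    have hξT : 0 ≤ |ξ| * |T| := by positivity
    have hc0 : 0 ≤ |ξ / (2 * lam)| := abs_nonneg _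
    refine norm_prod_le_iff.mpr ⟨?_, norm_prod_le_iff.mpr ⟨?_, ?_⟩⟩
    · simp only [solutionLin, fieldX, mul_one, Real.norm_eq_abs, abs_of_pos he0]
      linarith
    · simp only [solutionLin, fieldX, norm_zero]; exact hb0
    · have h1 : |ξ / (2 * lam) * (1 - decay lam t)| ≤ |ξ / (2 * lam)| := by
        rw [abs_mul, abs_of_nonneg (by linarith : 0 ≤ 1 - decay lam t)]
        exact mul_le_of_le_one_right hc0 (by linarith)
      have h2 := abs_sub (w.2.1 / 2) (ξ / (2 * lam) * (1 - decay lam t))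
      rw [abs_div, abs_two] at h2
      simp only [solutionLin, fieldX, mul_one, zero_div, zero_mul, add_zero, Real.norm_eq_abs]
      linarith
  have hD : ‖solutionLin lam ξ t N (driftField lam ξ w)‖ ≤ d * (1 + ‖N‖) := by
    have hR0 : 0 ≤ R := abs_nonneg _
    have hn := norm_nonneg N
    have hx' : R + 3 * τ * ‖N‖ ≤ (R + 3 * τ) * (1 + ‖N‖) := by nlinarith
    have hτN : τ * ‖N‖ ≤ τ * (1 + ‖N‖) := by nlinarith
    have hξ0 := abs_nonneg ξ
    have k1 : 0 ≤ (R + 3 * τ) * (1 + ‖N‖) := by positivity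
    have k2 : 0 ≤ |ξ| * (1 + ‖N‖) := by positivity
    have k3 : 0 ≤ |ξ| * (τ * (1 + ‖N‖)) := by positivity
    have k4 : 0 ≤ |ξ| * ((R + 3 * τ) * (1 + ‖N‖)) := by positivity
    have k5 : 0 ≤ lam * ((R + 3 * τ) * (1 + ‖N‖)) := by positivity
    have hdN : d * (1 + ‖N‖) = lam * ((R + 3 * τ) * (1 + ‖N‖)) + |ξ| * ((R + 3 * τ) * (1 + ‖N‖))
        + |ξ| * (1 + ‖N‖) + |ξ| * (τ * (1 + ‖N‖)) := by rw [hd]; ring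
    rw [hdN]
    refine norm_prod_le_iff.mpr ⟨?_, norm_prod_le_iff.mpr ⟨?_, ?_⟩⟩
    · have h1 : (solutionLin lam ξ t N (driftField lam ξ w)).1 = -(lam * (decay lam t * w.1)) := by
        simp only [solutionLin, driftField]; ring
      rw [h1, Real.norm_eq_abs, abs_neg, abs_mul, abs_of_pos hlam]
      have := mul_le_mul_of_nonneg_left (hx.trans hx') hlam.le
      linarith
    · simp only [solutionLin, driftField, Real.norm_eq_abs]
      have := mul_le_mul_of_nonneg_left hN1 hξ0
      linarith
    · have h1 : (solutionLin lam ξ t N (driftField lam ξ w)).2.2 =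
          -(ξ / 2 * (decay lam t * w.1)) + ξ / 2 * noiseB t N := by
        simp only [solutionLin, driftField]; field_simp; ring
      rw [h1, Real.norm_eq_abs]
      refine (abs_add_le _ _).trans ?_
      rw [abs_neg, abs_mul (ξ / 2) (decay lam t * w.1), abs_mul (ξ / 2) (noiseB t N), abs_div,
        abs_two]
      have h2 := mul_le_mul_of_nonneg_left (hx.trans hx') hξ0
      have h3 := mul_le_mul_of_nonneg_left (hB.trans hτN) hξ0
      linarith
  have e1 : |hess f v (solutionLin lam ξ t N (fieldX w)) (solutionLin lam ξ t N (fieldX w))| ≤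
      F₂ * b * b := by
    refine ((hess f v).le_opNorm₂ _ _).trans ?_
    gcongr
    exact hF₂ v
  have e2 : |fderiv ℝ f v (solutionLin lam ξ t N (driftField lam ξ w))| ≤
      F₁ * (d * (1 + ‖N‖)) := by
    refine ((fderiv ℝ f v).le_opNorm _).trans ?_
    gcongr
    exact hF₁ v
  have e3 : F₂ * b * b ≤ F₂ * b * b * (1 + ‖N‖) :=
    le_mul_of_one_le_right (by positivity) hN1
  refine (abs_add_le _ _).trans ?_
  linarith

/-! ### Test functions determine the semigroup -/

/-- Finite measures that agree on test functions are equal: the indicator of a bounded open set `U`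
is the increasing limit of the test functions `1 - (1 - f) ^ n`, where `0 ≤ f ≤ 1` is smooth with
support `U`. -/
lemma measure_ext_of_test {μ ν : Measure Space} [IsProbabilityMeasure μ] [IsProbabilityMeasure ν]
    (h : ∀ f : Space → ℝ, ContDiff ℝ ∞ f → HasCompactSupport f → ∫ w, f w ∂μ = ∫ w, f w ∂ν) :
    μ = ν := by
  have hbasis : TopologicalSpace.IsTopologicalBasis
      {U : Set Space | IsOpen U ∧ Bornology.IsBounded U} := by
    refine TopologicalSpace.isTopologicalBasis_of_isOpen_of_nhds (fun U hU => hU.1) ?_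
    intro a V ha hV
    exact ⟨V ∩ Metric.ball a 1, ⟨hV.inter Metric.isOpen_ball,
      Metric.isBounded_ball.subset Set.inter_subset_right⟩, ⟨ha, Metric.mem_ball_self one_pos⟩,
      Set.inter_subset_left⟩
  have hgen : (inferInstance : MeasurableSpace Space) =
      MeasurableSpace.generateFrom {U : Set Space | IsOpen U ∧ Bornology.IsBounded U} := by
    rw [← hbasis.borel_eq_generateFrom]
    exact BorelSpace.measurable_eq
  refine ext_of_generate_finite _ hgen ?_ ?_ (by simp)
  · rintro U ⟨hU1, hU2⟩ V ⟨hV1, -⟩ -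
    exact ⟨hU1.inter hV1, hU2.subset Set.inter_subset_left⟩
  rintro U ⟨hU, hUb⟩
  obtain ⟨f, hfs, hfd, hfr⟩ := hU.exists_contDiff_support_eq (n := ⊤)
  have hf01 : ∀ w, 0 ≤ f w ∧ f w ≤ 1 := fun w => hfr ⟨w, rfl⟩
  have hfd' : ContDiff ℝ ∞ f := hfd
  have hlim : ∀ w, Tendsto (fun n : ℕ => 1 - (1 - f w) ^ n) atTop
      (𝓝 (U.indicator (fun _ => (1 : ℝ)) w)) := by
    intro w
    by_cases hw : w ∈ U
    · have hpos : 0 < f w := lt_of_le_of_ne (hf01 w).1 (Ne.symm (by rwa [← hfs] at hw))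
      rw [Set.indicator_of_mem hw]
      simpa using (tendsto_pow_atTop_nhds_zero_of_lt_one (by linarith [(hf01 w).2])
        (by linarith : 1 - f w < 1)).const_sub 1
    · have h0 : f w = 0 := by rwa [← hfs, Function.notMem_support] at hw
      rw [Set.indicator_of_notMem hw, h0]
      simp
  have hconv : ∀ (ρ : Measure Space) [IsProbabilityMeasure ρ],
      Tendsto (fun n : ℕ => ∫ w, (1 - (1 - f w) ^ n) ∂ρ) atTop (𝓝 (ρ.real U)) := by
    intro ρ _
    rw [← integral_indicator_one hU.measurableSet]
    refine tendsto_integral_of_dominated_convergence (fun _ => 1) (fun n => ?_)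
      (integrable_const _) (fun n => Eventually.of_forall fun w => ?_)
      (Eventually.of_forall hlim)
    · have := hfd'.continuous
      exact Continuous.aestronglyMeasurable (by fun_prop)
    · have h1 : 0 ≤ 1 - f w := by linarith [(hf01 w).2]
      have h2 := pow_le_one₀ (n := n) h1 (by linarith [(hf01 w).1])
      have h3 := pow_nonneg h1 n
      rw [Real.norm_eq_abs, abs_le]
      constructor <;> linarith
  have hcs : ∀ n : ℕ, HasCompactSupport fun w => 1 - (1 - f w) ^ n := fun n => by
    refine HasCompactSupport.intro hUb.isCompact_closure fun w hw => ?_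
    have h0 : f w = 0 := by
      rw [← Function.notMem_support, hfs]; exact fun h => hw (subset_closure h)
    simp [h0]
  have heq : ∀ n : ℕ, ∫ w, (1 - (1 - f w) ^ n) ∂μ = ∫ w, (1 - (1 - f w) ^ n) ∂ν := fun n =>
    h _ (contDiff_const.sub ((contDiff_const.sub hfd').pow n)) (hcs n)
  have := tendsto_nhds_unique (hconv μ) ((tendsto_congr heq).mpr (hconv ν))
  rwa [Measure.real, Measure.real, ENNReal.toReal_eq_toReal_iff' (measure_ne_top _ _)
    (measure_ne_top _ _)] at this


/-! ### Comparison of two semigroups with the same generator -/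

lemma integral_comp_solution_measurable {f : Space → ℝ} (hf : Continuous f) (lam ξ r : ℝ)
    (μ : Measure Space) [IsProbabilityMeasure μ] :
    StronglyMeasurable fun N => ∫ w', f (solution lam ξ r w' N) ∂μ := by
  have h : StronglyMeasurable fun p : Space × Space => f (solution lam ξ r p.2 p.1) :=
    (hf.comp ((continuous_solution lam ξ r).comp continuous_swap)).stronglyMeasurable
  exact h.integral_prod_right'

lemma integrable_semigroupAct_comp_solution {lam ξ : ℝ} {L : (Space → ℝ) → Space → ℝ}
    {Q : ℝ≥0 → Kernel Space Space} (hQ : IsMarkovSemigroupGeneratedBy L Q) {f : Space → ℝ}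
    (hf : Continuous f) (hc : HasCompactSupport f) (h : ℝ≥0) (r : ℝ) (w : Space) :
    Integrable (fun N => semigroupAct Q h (fun w' => f (solution lam ξ r w' N)) w) stdGauss := by
  have := hQ.markov h
  obtain ⟨C, -, hC⟩ := exists_bound_test hf hc
  exact integrable_of_bounded (integral_comp_solution_measurable hf lam ξ r (Q h w)).measurable
    fun N => abs_semigroupAct_le hQ (fun w' => hC _) h w

/-- By Fubini's theorem, `Q_h P_r f` is a mixture of the functions `Q_h φ`, where `φ` runs through
the test functions obtained by freezing the noise in the solution map. -/
lemma semigroupAct_semigroupAct_solutionKernel {lam ξ : ℝ} {L : (Space → ℝ) → Space → ℝ}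
    {Q : ℝ≥0 → Kernel Space Space} (hQ : IsMarkovSemigroupGeneratedBy L Q) {f : Space → ℝ}
    (hf : Continuous f) (hc : HasCompactSupport f) (h r : ℝ≥0) (w : Space) :
    semigroupAct Q h (semigroupAct (solutionKernel lam ξ) r f) w =
      ∫ N, semigroupAct Q h (fun w' => f (solution lam ξ r w' N)) w ∂stdGauss := by
  have := hQ.markov h
  obtain ⟨C, -, hC⟩ := exists_bound_test hf hc
  rw [funext (semigroupAct_solutionKernel lam ξ r hf.measurable)]
  simp only [semigroupAct]
  refine integral_integral_swap (f := fun w' N => f (solution lam ξ r w' N)) ?_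
  exact Integrable.of_bound
    (hf.comp (continuous_solution lam ξ r)).aestronglyMeasurable C
    (Eventually.of_forall fun p => hC _)

section Comparison

variable {lam ξ : ℝ} {Q : ℝ≥0 → Kernel Space Space}

lemma integrable_one_add_norm (C : ℝ) : Integrable (fun N : Space => C * (1 + ‖N‖)) stdGauss := by
  have h : Integrable (fun N : Space => ‖N‖) stdGauss := by
    simpa using integrable_norm_pow_stdGauss 1
  exact ((integrable_const 1).add h).const_mul C

/-- Two semigroups with the same generator move a test function with frozen noise apart at most at
a speed that is integrable over the noise. -/
lemma exists_speed_bound (hlam : 0 < lam)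
    (hQ : IsMarkovSemigroupGeneratedBy (generator lam ξ) Q) {f : Space → ℝ}
    (hf : ContDiff ℝ ∞ f) (hc : HasCompactSupport f) (T : ℝ) :
    ∃ C, 0 ≤ C ∧ ∀ r : ℝ≥0, (r : ℝ) ≤ T → ∀ (h : ℝ≥0) (w N : Space),
      |semigroupAct Q h (fun w' => f (solution lam ξ r w' N)) w -
        semigroupAct (solutionKernel lam ξ) h (fun w' => f (solution lam ξ r w' N)) w| ≤
        C * (1 + ‖N‖) * h := by
  obtain ⟨C, hC0, hC⟩ := exists_generator_comp_solution_bound hlam ξ hf hc T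
  refine ⟨2 * C, by positivity, fun r hr h w N => ?_⟩
  have hcd := contDiff_comp_solution hf lam ξ r N
  have hcs := hasCompactSupport_comp_solution hc lam ξ r N
  have h1 := abs_semigroupAct_sub_le hQ hcd hcs (fun w => hC r r.2 hr w N) h w
  have h2 := abs_semigroupAct_sub_le (isMarkovSemigroupGeneratedBy_solutionKernel hlam ξ) hcd hcs
    (fun w => hC r r.2 hr w N) h w
  have h3 := abs_sub_le (semigroupAct Q h (fun w' => f (solution lam ξ r w' N)) w)
    (f (solution lam ξ r w N))
    (semigroupAct (solutionKernel lam ξ) h (fun w' => f (solution lam ξ r w' N)) w)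
  rw [abs_sub_comm (f (solution lam ξ r w N))] at h3
  linarith

lemma exists_semigroupAct_sub_bound (hlam : 0 < lam)
    (hQ : IsMarkovSemigroupGeneratedBy (generator lam ξ) Q) {f : Space → ℝ}
    (hf : ContDiff ℝ ∞ f) (hc : HasCompactSupport f) (T : ℝ) :
    ∃ C, 0 ≤ C ∧ ∀ r : ℝ≥0, (r : ℝ) ≤ T → ∀ (h : ℝ≥0) (w : Space),
      |semigroupAct Q h (semigroupAct (solutionKernel lam ξ) r f) w -
        semigroupAct (solutionKernel lam ξ) h (semigroupAct (solutionKernel lam ξ) r f) w| ≤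
        C * h := by
  have hP := isMarkovSemigroupGeneratedBy_solutionKernel hlam ξ
  obtain ⟨C, hC0, hC⟩ := exists_speed_bound hlam hQ hf hc T
  refine ⟨∫ N : Space, C * (1 + ‖N‖) ∂stdGauss, integral_nonneg fun N => by positivity,
    fun r hr h w => ?_⟩
  rw [semigroupAct_semigroupAct_solutionKernel hQ hf.continuous hc,
    semigroupAct_semigroupAct_solutionKernel hP hf.continuous hc,
    ← integral_sub (integrable_semigroupAct_comp_solution hQ hf.continuous hc h r w)
      (integrable_semigroupAct_comp_solution hP hf.continuous hc h r w), ← integral_mul_const]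
  rw [← Real.norm_eq_abs]
  exact norm_integral_le_of_norm_le ((integrable_one_add_norm C).mul_const (h : ℝ))
    (Eventually.of_forall fun N => hC r hr h w N)

/-- On the image of `P_r`, two semigroups with the same generator agree to first order. The
functions `P_r f` are not test functions, but mixtures of test functions, to which the dominated
convergence theorem applies. -/
lemma semigroupAct_sub_isLittleO (hlam : 0 < lam)
    (hQ : IsMarkovSemigroupGeneratedBy (generator lam ξ) Q) {f : Space → ℝ}
    (hf : ContDiff ℝ ∞ f) (hc : HasCompactSupport f) (r : ℝ≥0) {ε : ℝ} (hε : 0 < ε) :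
    ∀ᶠ h : ℝ≥0 in 𝓝[>] 0, ∀ w,
      |semigroupAct Q h (semigroupAct (solutionKernel lam ξ) r f) w -
        semigroupAct (solutionKernel lam ξ) h (semigroupAct (solutionKernel lam ξ) r f) w| ≤
        ε * h := by
  have hP := isMarkovSemigroupGeneratedBy_solutionKernel hlam ξ
  obtain ⟨C, hC0, hC⟩ := exists_speed_bound hlam hQ hf hc r
  let d : ℝ≥0 → Space → ℝ := fun h w =>
    |semigroupAct Q h (semigroupAct (solutionKernel lam ξ) r f) w -
        semigroupAct (solutionKernel lam ξ) h (semigroupAct (solutionKernel lam ξ) r f) w|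
  -- For each `h` choose a point at which the bound fails, if there is one.
  have hbad : ∀ h : ℝ≥0, ∃ u : Space, (∃ w, ε * h < d h w) → ε * h < d h u := fun h => by
    by_cases hw : ∃ w, ε * h < d h w
    · exact ⟨hw.choose, fun _ => hw.choose_spec⟩
    · exact ⟨0, fun h' => absurd h' hw⟩
  choose u hu using hbad
  let F : ℝ≥0 → Space → ℝ := fun h N =>
    (semigroupAct Q h (fun w' => f (solution lam ξ r w' N)) (u h) -
      semigroupAct (solutionKernel lam ξ) h (fun w' => f (solution lam ξ r w' N)) (u h)) / h
  have hlim : Tendsto (fun h => ∫ N, F h N ∂stdGauss) (𝓝[>] 0)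
      (𝓝 (∫ _, (0 : ℝ) ∂stdGauss)) := by
    refine tendsto_integral_filter_of_dominated_convergence (fun N => C * (1 + ‖N‖)) ?_ ?_
      (integrable_one_add_norm C) (Eventually.of_forall fun N => ?_)
    · exact Eventually.of_forall fun h =>
        (((integrable_semigroupAct_comp_solution hQ hf.continuous hc h r (u h)).sub
          (integrable_semigroupAct_comp_solution hP hf.continuous hc h r (u h))).div_const
            (h : ℝ)).aestronglyMeasurable
    · filter_upwards [self_mem_nhdsWithin] with h h0
      refine Eventually.of_forall fun N => ?_
      have h0' : (0 : ℝ) < h := NNReal.coe_pos.mpr h0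
      rw [Real.norm_eq_abs, abs_div, abs_of_pos h0', div_le_iff₀ h0']
      exact hC r le_rfl h (u h) N
    · have hcd := contDiff_comp_solution hf lam ξ r N
      have hcs := hasCompactSupport_comp_solution hc lam ξ r N
      rw [Metric.tendsto_nhds]
      intro δ hδ
      filter_upwards [Metric.tendstoUniformly_iff.mp (hQ.infinitesimal _ hcd hcs) (δ / 2)
        (by positivity), Metric.tendstoUniformly_iff.mp (hP.infinitesimal _ hcd hcs) (δ / 2)
        (by positivity)] with h h1 h2
      have g1 := h1 (u h)
      have g2 := h2 (u h)
      rw [Real.dist_eq, abs_lt] at g1 g2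
      simp only [F, Real.dist_eq, sub_zero]
      rw [abs_lt]
      rw [sub_div] at g1 g2 ⊢
      constructor <;> linarith
  rw [integral_zero, Metric.tendsto_nhds] at hlim
  filter_upwards [hlim ε hε, self_mem_nhdsWithin] with h h1 h0
  have h0' : (0 : ℝ) < h := NNReal.coe_pos.mpr h0
  by_contra! hex
  have h2 := hu h hex
  simp only [d] at h2
  rw [semigroupAct_semigroupAct_solutionKernel hQ hf.continuous hc,
    semigroupAct_semigroupAct_solutionKernel hP hf.continuous hc,
    ← integral_sub (integrable_semigroupAct_comp_solution hQ hf.continuous hc h r (u h))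
      (integrable_semigroupAct_comp_solution hP hf.continuous hc h r (u h))] at h2
  simp only [F, Real.dist_eq, sub_zero] at h1
  rw [integral_div, abs_div, abs_of_pos h0', div_lt_iff₀ h0'] at h1
  exact lt_asymm h1 h2

/-- The semigroup generated by `L` is unique: for a test function `f` the function
`s ↦ Q_{t - s} P_s f` is Lipschitz continuous with right derivative zero, hence constant. -/
theorem semigroupAct_eq (hlam : 0 < lam)
    (hQ : IsMarkovSemigroupGeneratedBy (generator lam ξ) Q) {f : Space → ℝ}
    (hf : ContDiff ℝ ∞ f) (hc : HasCompactSupport f) (t : ℝ≥0) (w : Space) :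
    semigroupAct Q t f w = semigroupAct (solutionKernel lam ξ) t f w := by
  set P := solutionKernel lam ξ with hPdef
  have hP : IsMarkovSemigroupGeneratedBy (generator lam ξ) P :=
    isMarkovSemigroupGeneratedBy_solutionKernel hlam ξ
  obtain ⟨C, hC0, hC⟩ := exists_bound_test hf.continuous hc
  have hfm := hf.continuous.measurable
  let k : ℝ → ℝ := fun s => semigroupAct Q (t - s.toNNReal) (semigroupAct P s.toNNReal f) w
  have hstep : ∀ (r h : ℝ≥0) (b : ℝ), r + h ≤ t →
      (∀ w, |semigroupAct Q h (semigroupAct P r f) w - semigroupAct P h (semigroupAct P r f) w| ≤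
        b) → |k (r + h) - k r| ≤ b := by
    intro r h b hrt hb
    have hPr := measurable_semigroupAct hP hfm r
    have hPrC := abs_semigroupAct_le hP hC r
    have h1 : k (r + h) = semigroupAct Q (t - (r + h))
        (semigroupAct P h (semigroupAct P r f)) w := by
      simp only [k, ← NNReal.coe_add, Real.toNNReal_coe]
      congr 1
      funext w'
      rw [add_comm, semigroupAct_add hP hfm hC]
    have h2 : k r = semigroupAct Q (t - (r + h)) (semigroupAct Q h (semigroupAct P r f)) w := by
      simp only [k, Real.toNNReal_coe]
      rw [← semigroupAct_add hQ hPr hPrC]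
      congr 2
      rw [tsub_add_eq_tsub_tsub, tsub_add_cancel_of_le]
      exact le_tsub_of_add_le_left hrt
    rw [h1, h2, abs_sub_comm, ← semigroupAct_sub hQ (measurable_semigroupAct hQ hPr h)
      (abs_semigroupAct_le hQ hPrC h) (measurable_semigroupAct hP hPr h)
      (abs_semigroupAct_le hP hPrC h)]
    exact abs_semigroupAct_le hQ hb _ _
  obtain ⟨M, hM0, hM⟩ := exists_semigroupAct_sub_bound hlam hQ hf hc t
  have hlip : ∀ r ∈ Set.Icc (0 : ℝ) t, ∀ s ∈ Set.Icc (0 : ℝ) t, r ≤ s →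
      |k s - k r| ≤ M * (s - r) := by
    intro r hr s hs hrs
    lift r to ℝ≥0 using hr.1
    obtain ⟨h, rfl⟩ : ∃ h : ℝ≥0, s = r + h := ⟨(s - r).toNNReal, by
      rw [Real.coe_toNNReal _ (sub_nonneg.mpr hrs)]; ring⟩
    rw [add_sub_cancel_left]
    exact hstep r h _ (by exact_mod_cast hs.2) (hM r hr.2 h)
  have hcont : ContinuousOn k (Set.Icc 0 t) := by
    refine (LipschitzOnWith.of_dist_le_mul (K := ⟨M, hM0⟩) fun r hr s hs => ?_).continuousOn
    rw [Real.dist_eq, Real.dist_eq]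
    rcases le_total r s with hrs | hrs
    · rw [abs_sub_comm, abs_sub_comm r, abs_of_nonneg (sub_nonneg.mpr hrs)]
      exact hlip r hr s hs hrs
    · rw [abs_of_nonneg (sub_nonneg.mpr hrs)]
      exact hlip s hs r hr hrs
  have hderiv : ∀ r ∈ Set.Ico (0 : ℝ) t, HasDerivWithinAt k 0 (Set.Ici r) r := by
    intro r hr
    lift r to ℝ≥0 using hr.1
    rw [hasDerivWithinAt_iff_isLittleO, Asymptotics.isLittleO_iff]
    intro ε hε
    have h1 := semigroupAct_sub_isLittleO hlam hQ hf hc r hε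
    obtain ⟨δ, hδ, hball⟩ := Metric.eventually_nhds_iff.mp (eventually_nhdsWithin_iff.mp h1)
    have hmem : Set.Ico (r : ℝ) (min (r + δ) t) ∈ 𝓝[≥] (r : ℝ) :=
      Ico_mem_nhdsGE (lt_min (by linarith) hr.2)
    filter_upwards [hmem] with s hs
    obtain ⟨h, rfl⟩ : ∃ h : ℝ≥0, s = r + h := ⟨(s - r).toNNReal, by
      rw [Real.coe_toNNReal _ (sub_nonneg.mpr hs.1)]; ring⟩
    rw [smul_zero, sub_zero, Real.norm_eq_abs, Real.norm_eq_abs, add_sub_cancel_left,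
      abs_of_nonneg h.coe_nonneg]
    rcases eq_or_ne h 0 with rfl | h0
    · simp
    · have hδh : (h : ℝ) < δ := by linarith [hs.2.trans_le (min_le_left _ _)]
      have hst : r + h ≤ t := by exact_mod_cast (hs.2.trans_le (min_le_right _ _)).le
      exact hstep r h _ hst (hball (by simpa [NNReal.dist_eq] using hδh) (pos_iff_ne_zero.mpr h0))
  have hconst := constant_of_has_deriv_right_zero hcont hderiv t ⟨t.2, le_rfl⟩
  have hend : k t = semigroupAct P t f w := by
    simp only [k, Real.toNNReal_coe, tsub_self, semigroupAct, hQ.zero, Kernel.id_apply]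
    exact integral_dirac' _ _ (measurable_semigroupAct hP hfm t).stronglyMeasurable
  have hstart : k 0 = semigroupAct Q t f w := by
    have h0 : semigroupAct P 0 f = f := by
      funext w'
      simp only [semigroupAct, hP.zero, Kernel.id_apply]
      exact integral_dirac' _ _ hfm.stronglyMeasurable
    simp only [k, Real.toNNReal_zero, tsub_zero, h0]
  rw [← hend, ← hstart, hconst]

theorem eq_solutionKernel (hlam : 0 < lam)
    (hQ : IsMarkovSemigroupGeneratedBy (generator lam ξ) Q) : Q = solutionKernel lam ξ := by
  funext t
  ext1 w
  have := hQ.markov t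
  exact measure_ext_of_test fun f hf hc => semigroupAct_eq hlam hQ hf hc t w

end Comparison

/-! ### Differentiation of Gaussian expectations along a shift -/

/-- The Cameron–Martin formula on the line. -/
lemma gaussianReal_eq_withDensity (h : ℝ) : gaussianReal h 1 =
    (gaussianReal 0 1).withDensity fun s => ENNReal.ofReal (Real.exp (h * s - h ^ 2 / 2)) := by
  rw [gaussianReal_of_var_ne_zero h one_ne_zero, gaussianReal_of_var_ne_zero 0 one_ne_zero,
    ← withDensity_mul _ (measurable_gaussianPDF 0 1) (by fun_prop)]
  congr 1
  funext s
  rw [Pi.mul_apply, gaussianPDF_def, gaussianPDF_def, ← ENNReal.ofReal_mul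
    (gaussianPDFReal_nonneg 0 1 s), gaussianPDFReal_def, gaussianPDFReal_def]
  simp only
  rw [mul_assoc (√(2 * Real.pi * ((1 : ℝ≥0) : ℝ)))⁻¹, ← Real.exp_add]
  congr 3
  simp
  ring

/-- The translation by `h` of the third coordinate. -/
def shift (h : ℝ) (N : Space) : Space := (N.1, N.2.1, N.2.2 + h)

lemma continuous_shift (h : ℝ) : Continuous (shift h) := by unfold shift; fun_prop

lemma measurable_shift (h : ℝ) : Measurable (shift h) := (continuous_shift h).measurable

lemma map_shift_stdGauss (h : ℝ) : stdGauss.map (shift h) =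
    stdGauss.withDensity fun N => ENNReal.ofReal (Real.exp (h * N.2.2 - h ^ 2 / 2)) := by
  have h1 : stdGauss.map (shift h) =
      (gaussianReal 0 1).prod ((gaussianReal 0 1).prod (gaussianReal h 1)) := by
    have hadd : gaussianReal h 1 = (gaussianReal 0 1).map (fun s => s + h) := by
      rw [gaussianReal_map_add_const, zero_add]
    have hm : Measurable fun s : ℝ => s + h := by fun_prop
    nth_rewrite 2 [← Measure.map_id (μ := gaussianReal 0 1)]
    nth_rewrite 1 [← Measure.map_id (μ := gaussianReal 0 1)]
    rw [hadd, Measure.map_prod_map _ _ measurable_id hm,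
      Measure.map_prod_map _ _ measurable_id (measurable_id.prodMap hm)]
    rfl
  rw [h1, gaussianReal_eq_withDensity h, prod_withDensity_right (by fun_prop),
    prod_withDensity_right (by fun_prop)]
  rfl

lemma integral_shift {G : Space → ℝ} (hG : Measurable G) (h : ℝ) :
    ∫ N, G (shift h N) ∂stdGauss =
      ∫ N, Real.exp (h * N.2.2 - h ^ 2 / 2) * G N ∂stdGauss := by
  rw [← integral_map (measurable_shift h).aemeasurable hG.aestronglyMeasurable,
    map_shift_stdGauss, integral_withDensity_eq_integral_toReal_smul (by fun_prop) (by simp)]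
  simp [Real.exp_nonneg]

lemma integrable_shift_iff {G : Space → ℝ} (hG : Measurable G) (h : ℝ) :
    Integrable (fun N => G (shift h N)) stdGauss ↔
      Integrable (fun N => Real.exp (h * N.2.2 - h ^ 2 / 2) * G N) stdGauss := by
  have h1 : Integrable (fun N => G (shift h N)) stdGauss ↔
      Integrable G (stdGauss.map (shift h)) :=
    (integrable_map_measure hG.aestronglyMeasurable (measurable_shift h).aemeasurable).symm
  rw [h1, map_shift_stdGauss, integrable_withDensity_iff_integrable_smul' (by fun_prop) (by simp)]
  simp [Real.exp_nonneg]

/-- A Gaussian expectation is differentiable along a shift, without any regularity of the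
integrand: the derivative falls on the Gaussian density. -/
lemma hasDerivAt_integral_shift {G : Space → ℝ} (hG : Measurable G)
    (hint : ∀ h, Integrable (fun N => G (shift h N)) stdGauss) :
    Integrable (fun N => N.2.2 * G N) stdGauss ∧
    HasDerivAt (fun h => ∫ N, G (shift h N) ∂stdGauss) (∫ N, N.2.2 * G N ∂stdGauss) 0 := by
  have hint' := fun h => (integrable_shift_iff hG h).mp (hint h)
  have hderiv : ∀ (N : Space) (h : ℝ), HasDerivAt
      (fun h => Real.exp (h * N.2.2 - h ^ 2 / 2) * G N)
      (Real.exp (h * N.2.2 - h ^ 2 / 2) * (1 * N.2.2 - 2 * h / 2) * G N) h := fun N h => by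
    have h1 : HasDerivAt (fun h : ℝ => h * N.2.2 - h ^ 2 / 2) (1 * N.2.2 - 2 * h / 2) h :=
      ((hasDerivAt_id' h).mul_const _).fun_sub
        ((by simpa using hasDerivAt_pow 2 h :
          HasDerivAt (fun h : ℝ => h ^ 2) (2 * h) h).div_const 2)
    exact h1.exp.mul_const _
  -- For `|h| < 1` the derivative is dominated by the densities of the shifts by `2` and `-2`.
  have hbound : ∀ (N : Space), ∀ h ∈ Metric.ball (0 : ℝ) 1,
      ‖Real.exp (h * N.2.2 - h ^ 2 / 2) * (1 * N.2.2 - 2 * h / 2) * G N‖ ≤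
        Real.exp 2 * (‖Real.exp (2 * N.2.2 - 2 ^ 2 / 2) * G N‖
          + ‖Real.exp (-2 * N.2.2 - (-2) ^ 2 / 2) * G N‖) := by
    intro N h hh
    rw [Metric.mem_ball, dist_zero_right, Real.norm_eq_abs] at hh
    set s := N.2.2
    have e1 : Real.exp (h * s - h ^ 2 / 2) ≤ Real.exp |s| := by
      apply Real.exp_le_exp.mpr
      have h2 : h * s ≤ |s| := (le_abs_self _).trans (by
        rw [abs_mul]; exact mul_le_of_le_one_left (abs_nonneg _) hh.le)
      nlinarith [sq_nonneg h]
    have e2 : |1 * s - 2 * h / 2| ≤ Real.exp |s| := by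
      have h3 : |1 * s - 2 * h / 2| ≤ |s| + 1 := by
        have := abs_sub s h
        rw [show 1 * s - 2 * h / 2 = s - h by ring]
        linarith
      exact h3.trans (Real.add_one_le_exp _)
    have e3 : Real.exp |s| * Real.exp |s| ≤ Real.exp 2 * (Real.exp (2 * s - 2 ^ 2 / 2)
        + Real.exp (-2 * s - (-2) ^ 2 / 2)) := by
      rw [mul_add, ← Real.exp_add, ← Real.exp_add, ← Real.exp_add]
      have p1 := (Real.exp_pos (2 + (2 * s - 2 ^ 2 / 2))).le
      have p2 := (Real.exp_pos (2 + (-2 * s - (-2) ^ 2 / 2))).le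
      rcases abs_cases s with ⟨hs, -⟩ | ⟨hs, -⟩
      · rw [hs, show s + s = 2 + (2 * s - 2 ^ 2 / 2) by ring]; linarith
      · rw [hs, show -s + -s = 2 + (-2 * s - (-2) ^ 2 / 2) by ring]; linarith
    simp only [norm_mul, Real.norm_eq_abs, abs_of_pos (Real.exp_pos _)]
    rw [← add_mul, ← mul_assoc]
    refine mul_le_mul_of_nonneg_right (le_trans ?_ e3) (abs_nonneg _)
    exact mul_le_mul e1 e2 (abs_nonneg _) (Real.exp_pos _).le
  have hmain := hasDerivAt_integral_of_dominated_loc_of_deriv_le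
    (μ := stdGauss) (x₀ := (0 : ℝ)) (F := fun h N => Real.exp (h * N.2.2 - h ^ 2 / 2) * G N)
    (F' := fun h N => Real.exp (h * N.2.2 - h ^ 2 / 2) * (1 * N.2.2 - 2 * h / 2) * G N)
    (Metric.ball_mem_nhds 0 one_pos) (Eventually.of_forall fun h => (hint' h).aestronglyMeasurable)
    (hint' 0) (by fun_prop) (Eventually.of_forall hbound)
    (((hint' 2).norm.add (hint' (-2)).norm).const_mul _)
    (Eventually.of_forall fun N h _ => hderiv N h)
  simp only [integral_shift hG]
  simpa using hmain

/-- Gaussian integration by parts on the line. The function `g` is differentiable everywhere, but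
its derivative need not be continuous. -/
lemma integral_deriv_sub_id_mul_gaussianReal {g g' : ℝ → ℝ} (hg : ∀ s, HasDerivAt g (g' s) s)
    (hi : Integrable g (gaussianReal 0 1))
    (hi' : Integrable (fun s => g' s - s * g s) (gaussianReal 0 1)) :
    ∫ s, (g' s - s * g s) ∂gaussianReal 0 1 = 0 := by
  have hpdf : ∀ s : ℝ, HasDerivAt (gaussianPDFReal 0 1) (-s * gaussianPDFReal 0 1 s) s := by
    intro s
    rw [gaussianPDFReal_def]
    have h1 : HasDerivAt (fun s : ℝ => -(s - 0) ^ 2 / (2 * ((1 : ℝ≥0) : ℝ))) (-s) s := by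
      have h2 := ((hasDerivAt_pow 2 s).fun_neg).div_const (2 * ((1 : ℝ≥0) : ℝ))
      simp only [sub_zero]
      refine h2.congr_deriv ?_
      simp
      ring
    refine (h1.exp.const_mul _).congr_deriv ?_
    ring
  rw [integral_gaussianReal_eq_integral_smul one_ne_zero]
  rw [gaussianReal_of_var_ne_zero 0 one_ne_zero, integrable_withDensity_iff_integrable_smul'
    (measurable_gaussianPDF 0 1) (by simp [gaussianPDF_lt_top])] at hi hi'
  simp only [toReal_gaussianPDF, smul_eq_mul] at hi hi' ⊢
  refine integral_eq_zero_of_hasDerivAt_of_integrable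
    (f := fun s => gaussianPDFReal 0 1 s * g s) (fun s => ?_) hi' hi
  exact ((hpdf s).mul (hg s)).congr_deriv (by ring)

/-- Gaussian integration by parts in the third coordinate, one line at a time. -/
lemma integral_snd_snd_mul {G G' : Space → ℝ} (hG : Integrable G stdGauss)
    (hG' : Integrable G' stdGauss) (hsG : Integrable (fun N => N.2.2 * G N) stdGauss)
    (hd : ∀ a b s : ℝ, HasDerivAt (fun s => G (a, b, s)) (G' (a, b, s)) s) :
    ∫ N, N.2.2 * G N ∂stdGauss = ∫ N, G' N ∂stdGauss := by
  have hK : Integrable (fun N => G' N - N.2.2 * G N) stdGauss := hG'.sub hsG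
  have hzero : ∫ N, (G' N - N.2.2 * G N) ∂stdGauss = 0 := by
    unfold stdGauss at hK hG ⊢
    rw [integral_prod _ hK]
    refine integral_eq_zero_of_ae ?_
    filter_upwards [hK.prod_right_ae, hG.prod_right_ae] with a hKa hGa
    rw [integral_prod _ hKa]
    refine integral_eq_zero_of_ae ?_
    filter_upwards [hKa.prod_right_ae, hGa.prod_right_ae] with b hKb hGb
    exact integral_deriv_sub_id_mul_gaussianReal (hd a b) hGb hKb
  rw [integral_sub hG' hsG] at hzero
  linarith

lemma ofReal_sq_integral_le {Ω : Type*} [MeasurableSpace Ω] {μ : Measure Ω}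
    [IsProbabilityMeasure μ] {g : Ω → ℝ} (hg : MemLp g 2 μ) :
    ENNReal.ofReal ((∫ w, g w ∂μ) ^ 2) ≤ ∫⁻ w, ENNReal.ofReal (g w ^ 2) ∂μ := by
  rw [← ofReal_integral_eq_lintegral_ofReal hg.integrable_sq
    (Eventually.of_forall fun w => sq_nonneg _)]
  refine ENNReal.ofReal_le_ofReal ?_
  have h := variance_nonneg g μ
  rw [variance_eq_sub hg] at h
  simp only [Pi.pow_apply] at h
  linarith

/-! ### The gradient estimate along `V` -/

variable {lam ξ : ℝ}

/-- The flow contracts the direction `V` by the factor `e^{-lam t}`. -/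
lemma solution_add_smul_fieldV (hlam : 0 < lam) (hξ : 0 < ξ) (t h : ℝ) (w u N : Space) :
    solution lam ξ t (w + h • fieldV lam ξ u) N =
      solution lam ξ t w N + (h * decay lam t) • fieldV lam ξ u := by
  have hκ : √(2 * lam / ξ) ≠ 0 := by positivity
  have hκ2 : ξ / (2 * lam) * √(2 * lam / ξ) = (√(2 * lam / ξ))⁻¹ := by
    field_simp
    rw [Real.sq_sqrt (by positivity)]
    field_simp
  rw [solution_add_smul, mul_smul]
  congr 2
  ext
  · simp [solutionLin, fieldV]
  · simp [solutionLin, fieldV]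
  · simp only [solutionLin, fieldV, Prod.smul_snd, smul_eq_mul, zero_div, zero_mul, add_zero]
    linear_combination (-(1 - decay lam t)) * hκ2

/-- The third noise variable acts in the direction `V`. -/
lemma solution_shift (hlam : 0 < lam) (hξ : 0 < ξ) (t h : ℝ) (w u N : Space) :
    solution lam ξ t w (shift h N) =
      solution lam ξ t w N + (chol₃ lam t / √(2 * lam / ξ) * h) • fieldV lam ξ u := by
  have hκ : √(2 * lam / ξ) ≠ 0 := by positivity
  have hκ2 : (√(2 * lam / ξ))⁻¹ / √(2 * lam / ξ) = ξ / (2 * lam) := by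
    field_simp
    rw [Real.sq_sqrt (by positivity)]
    field_simp
  ext
  · simp only [solution, noise, noiseA, shift, fieldV, Prod.fst_add, Prod.smul_fst, smul_eq_mul]
    field_simp
    ring
  · simp [solution, noise, shift, fieldV]
  · simp only [solution, noise, noiseA, noiseB, noiseC, shift, fieldV, Prod.snd_add,
      Prod.smul_snd, smul_eq_mul]
    linear_combination (-(chol₃ lam t * h)) * hκ2

lemma measurable_act_fieldV {f : Space → ℝ} (hf : Measurable f)
    (hd : ∀ w, LineDifferentiableAt ℝ f w (fieldV lam ξ w)) :
    Measurable (act (fieldV lam ξ) f) := by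
  have hlim : Tendsto (fun (n : ℕ) w => ((n : ℝ) + 1) *
      (f (w + ((n : ℝ) + 1)⁻¹ • fieldV lam ξ w) - f w)) atTop (𝓝 (act (fieldV lam ξ) f)) := by
    rw [tendsto_pi_nhds]
    intro w
    have h1 : HasDerivAt (fun s : ℝ => f (w + s • fieldV lam ξ w)) (act (fieldV lam ξ) f w) 0 :=
      (hd w).hasLineDerivAt
    have h2 : Tendsto (fun n : ℕ => ((n : ℝ) + 1)⁻¹) atTop (𝓝[≠] 0) := by
      refine tendsto_nhdsWithin_iff.mpr ⟨?_, Eventually.of_forall fun n => ?_⟩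
      · simpa using tendsto_one_div_add_atTop_nhds_zero_nat (𝕜 := ℝ)
      · have : (0 : ℝ) < (n : ℝ) + 1 := by positivity
        exact (inv_pos.mpr this).ne'
    have h3 := (hasDerivAt_iff_tendsto_slope_zero.mp h1).comp h2
    simpa [Function.comp_def] using h3
  refine measurable_of_tendsto_metrizable (fun n => ?_) hlim
  have h4 : Measurable fun w : Space => w + ((n : ℝ) + 1)⁻¹ • fieldV lam ξ w := by
    unfold fieldV; fun_prop
  exact ((hf.comp h4).sub hf).const_mul _

/-- The gradient estimate for positive times. The semigroup is represented as a Gaussian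
expectation in which the third noise variable shifts the argument in the direction `V`. -/
lemma gradient_estimate_of_pos (hlam : 0 < lam) (hξ : 0 < ξ) {t : ℝ≥0} (ht : 0 < t)
    {f : Space → ℝ} (hf : Measurable f)
    (hd : ∀ w, LineDifferentiableAt ℝ f w (fieldV lam ξ w))
    (hint : ∀ w, Integrable f (solutionKernel lam ξ t w)) (w : Space) :
    LineDifferentiableAt ℝ (semigroupAct (solutionKernel lam ξ) t f) w (fieldV lam ξ w) ∧
      ENNReal.ofReal ((act (fieldV lam ξ) (semigroupAct (solutionKernel lam ξ) t f) w) ^ 2) ≤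
        ENNReal.ofReal (Real.exp (-2 * lam * (t : ℝ))) *
          ∫⁻ w', ENNReal.ofReal ((act (fieldV lam ξ) f w') ^ 2) ∂(solutionKernel lam ξ t w) := by
  have ht' : (0 : ℝ) < t := ht
  set V := fieldV lam ξ w with hV
  have hVc : ∀ u, fieldV lam ξ u = V := fun u => rfl
  set κ := √(2 * lam / ξ) with hκdef
  have hκ : 0 < κ := by positivity
  set a := chol₃ lam t with hadef
  have ha : 0 < a := chol₃_pos hlam ht'
  set e := decay lam t with hedef
  have he : 0 < e := decay_pos lam t
  -- The shift of the noise that corresponds to the unit shift of the starting point along `V`.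
  set τ := e * κ / a with hτdef
  have hτ : 0 < τ := by positivity
  have hsol : ∀ (h : ℝ) (N : Space), solution lam ξ t (w + h • V) N =
      solution lam ξ t w (shift (h * τ) N) := fun h N => by
    rw [hV, solution_add_smul_fieldV hlam hξ, solution_shift hlam hξ t (h * τ) w w]
    congr 2
    rw [← hκdef, ← hadef, ← hedef, hτdef]
    field_simp
  let G : Space → ℝ := fun N => f (solution lam ξ t w N)
  have hG : Measurable G := hf.comp (measurable_solution lam ξ t w)
  have hGint : ∀ h, Integrable (fun N => G (shift h N)) stdGauss := fun h => by
    have h1 := hint (w + (h / τ) • V)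
    rw [solutionKernel_apply, integrable_map_measure hf.aestronglyMeasurable
      (measurable_solution lam ξ t _).aemeasurable] at h1
    refine h1.congr (Eventually.of_forall fun N => ?_)
    simp only [Function.comp_apply, hsol, G, div_mul_cancel₀ h hτ.ne']
  obtain ⟨hsG, hder⟩ := hasDerivAt_integral_shift hG hGint
  have hact : ∀ h : ℝ, semigroupAct (solutionKernel lam ξ) t f (w + h • V) =
      ∫ N, G (shift (h * τ) N) ∂stdGauss := fun h => by
    rw [semigroupAct_solutionKernel lam ξ t hf]
    simp only [hsol, G]
  have hline : HasLineDerivAt ℝ (semigroupAct (solutionKernel lam ξ) t f)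
      ((∫ N, N.2.2 * G N ∂stdGauss) * (1 * τ)) w V := by
    rw [HasLineDerivAt, funext hact]
    have h1 : HasDerivAt (fun h : ℝ => h * τ) (1 * τ) 0 := (hasDerivAt_id' 0).mul_const τ
    exact HasDerivAt.comp (h₂ := fun h => ∫ N, G (shift h N) ∂stdGauss) 0
      (by simpa using hder) h1
  refine ⟨hline.lineDifferentiableAt, ?_⟩
  have hval : act (fieldV lam ξ) (semigroupAct (solutionKernel lam ξ) t f) w =
      τ * ∫ N, N.2.2 * G N ∂stdGauss := by
    rw [act, hVc, hline.lineDeriv]; ring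
  have hmeas := measurable_act_fieldV hf hd
  have hexp : Real.exp (-2 * lam * (t : ℝ)) = e ^ 2 := by
    rw [hedef, decay, ← Real.exp_nat_mul]; congr 1; push_cast; ring
  rw [hexp, solutionKernel_apply, lintegral_map (by fun_prop) (measurable_solution lam ξ t w)]
  by_cases htop : ∫⁻ N, ENNReal.ofReal ((act (fieldV lam ξ) f (solution lam ξ t w N)) ^ 2)
      ∂stdGauss = ⊤
  · rw [htop, ENNReal.mul_top (ENNReal.ofReal_pos.mpr (pow_pos he 2)).ne']
    exact le_top
  let g : Space → ℝ := fun N => act (fieldV lam ξ) f (solution lam ξ t w N)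
  have hg : Measurable g := hmeas.comp (measurable_solution lam ξ t w)
  have hg2 : MemLp g 2 stdGauss := by
    rw [memLp_two_iff_integrable_sq hg.aestronglyMeasurable]
    refine ⟨(hg.pow_const 2).aestronglyMeasurable, ?_⟩
    rw [hasFiniteIntegral_iff_ofReal (Eventually.of_forall fun N => sq_nonneg _)]
    exact lt_top_iff_ne_top.mpr htop
  have hgi : Integrable g stdGauss := hg2.integrable one_le_two
  have hGd : ∀ x b s : ℝ, HasDerivAt (fun s => G (x, b, s)) (a / κ * g (x, b, s)) s := by
    intro x b s
    have h1 : ∀ s', G (x, b, s') = f (solution lam ξ t w (x, b, s) + (a / κ * (s' - s)) • V) := by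
      intro s'
      have h2 : ((x, b, s') : Space) = shift (s' - s) (x, b, s) := by simp [shift]
      simp only [G]
      rw [h2, solution_shift hlam hξ t (s' - s) w w]
    rw [funext h1]
    have h3 : HasDerivAt (fun r : ℝ => f (solution lam ξ t w (x, b, s) + r • V)) (g (x, b, s)) 0 :=
      (hd (solution lam ξ t w (x, b, s))).hasLineDerivAt
    have h4 : HasDerivAt (fun s' : ℝ => a / κ * (s' - s)) (a / κ * 1) s :=
      ((hasDerivAt_id' s).sub_const s).const_mul _
    refine (HasDerivAt.comp (h₂ := fun r : ℝ => f (solution lam ξ t w (x, b, s) + r • V)) s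
      (by simpa using h3) h4).congr_deriv ?_
    ring
  have hG0 : Integrable G stdGauss := by simpa [shift] using hGint 0
  have hibp := integral_snd_snd_mul hG0 (hgi.const_mul (a / κ)) hsG hGd
  have hfin : act (fieldV lam ξ) (semigroupAct (solutionKernel lam ξ) t f) w =
      e * ∫ N, g N ∂stdGauss := by
    rw [hval, hibp, integral_const_mul, hτdef]
    field_simp
  rw [hfin, mul_pow, ENNReal.ofReal_mul (by positivity)]
  gcongr
  exact ofReal_sq_integral_le hg2

theorem gradient_estimate (hlam : 0 < lam) (hξ : 0 < ξ) (t : ℝ≥0) {f : Space → ℝ}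
    (hf : Measurable f) (hd : ∀ w, LineDifferentiableAt ℝ f w (fieldV lam ξ w))
    (hint : ∀ w, Integrable f (solutionKernel lam ξ t w)) (w : Space) :
    LineDifferentiableAt ℝ (semigroupAct (solutionKernel lam ξ) t f) w (fieldV lam ξ w) ∧
      ENNReal.ofReal ((act (fieldV lam ξ) (semigroupAct (solutionKernel lam ξ) t f) w) ^ 2) ≤
        ENNReal.ofReal (Real.exp (-2 * lam * (t : ℝ))) *
          ∫⁻ w', ENNReal.ofReal ((act (fieldV lam ξ) f w') ^ 2) ∂(solutionKernel lam ξ t w) := by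
  rcases eq_or_ne t 0 with rfl | ht
  · have h0 : semigroupAct (solutionKernel lam ξ) 0 f = f := by
      funext w'
      simp only [semigroupAct, solutionKernel_zero, Kernel.id_apply]
      exact integral_dirac' _ _ hf.stronglyMeasurable
    rw [h0, solutionKernel_zero, Kernel.id_apply, lintegral_dirac]
    exact ⟨hd w, by simp⟩
  · exact gradient_estimate_of_pos hlam hξ (pos_iff_ne_zero.mpr ht) hf hd hint w

/-! ### Absence of an invariant probability measure -/

/-- The second coordinate moves with constant speed `ξ`, so the distribution function of the
second coordinate under an invariant measure would be constant. -/
theorem not_invariant (hξ : 0 < ξ) (μ : Measure Space) [IsProbabilityMeasure μ]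
    (h : ∀ t, (solutionKernel lam ξ t).Invariant μ) : False := by
  have hy : Measurable fun w : Space => w.2.1 := by fun_prop
  set ν := μ.map fun w : Space => w.2.1 with hν
  have : IsProbabilityMeasure ν := Measure.isProbabilityMeasure_map hy.aemeasurable
  have hconst : ∀ (t : ℝ≥0) (x : ℝ), cdf ν x = cdf ν (x - ξ * t) := by
    intro t x
    rw [cdf_eq_real, cdf_eq_real, measureReal_def, measureReal_def, hν,
      Measure.map_apply hy measurableSet_Iic, Measure.map_apply hy measurableSet_Iic]
    nth_rewrite 1 [← h t]
    have hS : MeasurableSet ((fun w : Space => w.2.1) ⁻¹' Set.Iic x) := hy measurableSet_Iic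
    rw [Measure.bind_apply hS (Kernel.aemeasurable _)]
    have hind : ∀ w, solutionKernel lam ξ t w ((fun w : Space => w.2.1) ⁻¹' Set.Iic x) =
        ((fun w : Space => w.2.1) ⁻¹' Set.Iic (x - ξ * t)).indicator 1 w := by
      intro w
      rw [solutionKernel_apply, Measure.map_apply (measurable_solution lam ξ t w) hS]
      by_cases hw : w.2.1 ≤ x - ξ * t
      · rw [Set.indicator_of_mem (by exact hw)]
        have : solution lam ξ t w ⁻¹' ((fun w : Space => w.2.1) ⁻¹' Set.Iic x) = Set.univ := by
          ext N
          simp only [Set.mem_preimage, solution_snd, Set.mem_Iic, Set.mem_univ, iff_true]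
          linarith
        rw [this, measure_univ, Pi.one_apply]
      · rw [Set.indicator_of_notMem (by exact hw)]
        have : solution lam ξ t w ⁻¹' ((fun w : Space => w.2.1) ⁻¹' Set.Iic x) = ∅ := by
          ext N
          simp only [Set.mem_preimage, solution_snd, Set.mem_Iic, Set.mem_empty_iff_false,
            iff_false]
          intro h'
          exact hw (by linarith)
        rw [this, measure_empty]
    rw [lintegral_congr hind, lintegral_indicator_one (hy measurableSet_Iic)]
  have hzero : ∀ x, cdf ν x = 0 := by
    intro x
    have h1 : Tendsto (fun n : ℕ => x - ξ * (n : ℝ)) atTop atBot :=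
      tendsto_atBot_add_const_left atTop x
        (tendsto_neg_atTop_atBot.comp (tendsto_natCast_atTop_atTop.const_mul_atTop hξ))
    have h2 := (tendsto_cdf_atBot ν).comp h1
    refine tendsto_nhds_unique (tendsto_const_nhds.congr fun n => ?_) h2
    simpa using hconst n x
  have h3 := tendsto_cdf_atTop ν
  rw [funext hzero] at h3
  exact zero_ne_one (tendsto_nhds_unique tendsto_const_nhds h3)

end Heisenberg

theorem mainTheorem5 (lam ξ : ℝ) (hlam : 0 < lam) (hξ : 0 < ξ) :
    ∃ P : ℝ≥0 → Kernel Heisenberg.Space Heisenberg.Space,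
      -- `P` is the Markov semigroup generated by `L`
      (Heisenberg.IsMarkovSemigroupGeneratedBy (Heisenberg.generator lam ξ) P ∧
        ∀ Q : ℝ≥0 → Kernel Heisenberg.Space Heisenberg.Space,
          Heisenberg.IsMarkovSemigroupGeneratedBy (Heisenberg.generator lam ξ) Q → Q = P) ∧
      -- the concentration property along `V`
      (∀ (t : ℝ≥0) (f : Heisenberg.Space → ℝ), Measurable f →
        (∀ w, LineDifferentiableAt ℝ f w (Heisenberg.fieldV lam ξ w)) →
        (∀ w, Integrable f (P t w)) →
        ∀ w, LineDifferentiableAt ℝ (Heisenberg.semigroupAct P t f) w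
              (Heisenberg.fieldV lam ξ w) ∧
          ENNReal.ofReal
              ((Heisenberg.act (Heisenberg.fieldV lam ξ) (Heisenberg.semigroupAct P t f) w) ^ 2)
            ≤ ENNReal.ofReal (Real.exp (-2 * lam * (t : ℝ))) *
              ∫⁻ w', ENNReal.ofReal ((Heisenberg.act (Heisenberg.fieldV lam ξ) f w') ^ 2)
                ∂(P t w)) ∧
      -- there is no invariant probability measure
      ¬ ∃ μ : Measure Heisenberg.Space, IsProbabilityMeasure μ ∧
        ∀ t, (P t).Invariant μ := by
  refine ⟨Heisenberg.solutionKernel lam ξ,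
    ⟨Heisenberg.isMarkovSemigroupGeneratedBy_solutionKernel hlam ξ,
      fun Q hQ => Heisenberg.eq_solutionKernel hlam hQ⟩,
    fun t f hf hd hint w => Heisenberg.gradient_estimate hlam hξ t hf hd hint w, ?_⟩
  rintro ⟨μ, hμ, hinv⟩
  exact Heisenberg.not_invariant hξ μ hinv
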